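/- For $\Re s>1$ let $S_0(s)=\sum_{(p_1,p_2)\in\mathbb Z^2\setminus\{(0,0)\}}(p_1^2+p_2^2)^{-s}$, and denote by $S_0$ also the analytic continuation to $\mathbb C\setminus\{1\}$; its trivial zeros are $s=-1,-2,-3,\dots$ and all its other zeros are called nontrivial. Let $\xi_1(s)=\pi^{-s/2}\Gamma(s/2)\zeta(s)$, a meromorphic function with poles only at $0$ and $1$, and $$\mathcal L(s)=s\,\xi_1(2s)+(1-s)\,\xi_1(2s-1),\qquad \mathcal U(s)=\frac{\xi_1(2s-1)}{\xi_1(2s)}.$$ Let $$\mathcal K(1,1;s)=\pi\sum_{p_1,p_2=1}^\infty \frac{p_2^{\,s+1/2}}{p_1^{\,s-3/2}}\,K_{s+1/2}(2\pi p_1p_2),$$ where $K_\nu$ is the MacDonald function (modified Bessel function of the second kind), and $$\mathcal U_{\mathcal K}(1,1;s)=\frac{\mathcal K(1,1;s)}{\mathcal K(1,1;1-s)},\qquad \mathcal F(s)=\frac{\mathcal U_{\mathcal K}(1,1;s)}{\mathcal U(s)} .$$ Let $s_0\in\mathbb C\setminus\{0,\tfrac12,1\}$. (1) If $s_0$ is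 a nontrivial zero of $S_0$, then $\mathcal K(1,1;s_0)\,\xi_1(2s_0)=-\mathcal K(1,1;1-s_0)\,\xi_1(2s_0-1)$. If moreover $\xi_1(2s_0)\ne0$ and $\xi_1(2s_0-1)\neq 0$, then $\mathcal K(1,1;1-s_0)\ne0$, so that $\mathcal F(s_0)$ is defined, and $\mathcal F(s_0)=-1$. (2) Conversely, if $\mathcal F(s_0)=-1$ (as a quotient whose denominators do not vanish, or as the limit $\lim_{s\to s_0}\mathcal F(s)=-1$), then either $\mathcal L(s_0)=0$ or $s_0$ is a nontrivial zero of $S_0$; and if $\mathcal L(s_0)=0$, then $s_0$ lies on the critical line $\Re s=\tfrac12$. -/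

import Mathlib

open Complex Filter Topology

namespace SquareLattice

/-! ### The lattice sum over the square lattice and its analytic continuation -/

/-- `S` is the analytic continuation to `ℂ ∖ {1}` of the lattice sum
`∑' (p₁² + p₂²)^(-s)` over all integer pairs `(p₁, p₂) ≠ (0, 0)`, which converges for `1 < Re s`. -/
def IsLatticeSumContinuation (S : ℂ → ℂ) : Prop :=
  DifferentiableOn ℂ S {1}ᶜ ∧
    ∀ s : ℂ, 1 < s.re →
      HasSum (fun p : {p : ℤ × ℤ // p ≠ 0} =>
        1 / ((p.1.1 : ℂ) ^ 2 + (p.1.2 : ℂ) ^ 2) ^ s) (S s)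

theorem thetaSq_feq (x : ℝ) (hx : x ∈ Set.Ioi (0 : ℝ)) :
    ((HurwitzZeta.evenKernel 0 (1 / x) : ℝ) : ℂ) ^ 2 =
      ((1 : ℂ) * ((x ^ (1 : ℝ) : ℝ) : ℂ)) • ((HurwitzZeta.evenKernel 0 x : ℝ) : ℂ) ^ 2 := by
  have hx0 : (0 : ℝ) < x := hx
  have h := HurwitzZeta.evenKernel_functional_equation 0 (1 / x)
  rw [← HurwitzZeta.evenKernel_eq_cosKernel_of_zero, one_div_one_div, one_div x,
    Real.inv_rpow hx0.le, one_div, inv_inv] at h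
  rw [one_div, h, smul_eq_mul, one_mul, Real.rpow_one, ofReal_mul, mul_pow, ← ofReal_pow,
    ← Real.rpow_natCast, ← Real.rpow_mul hx0.le]
  norm_num

theorem thetaSq_top (r : ℝ) :
    (fun t : ℝ => ((HurwitzZeta.evenKernel 0 t : ℝ) : ℂ) ^ 2 - 1) =O[atTop] (· ^ r) := by
  obtain ⟨p, hp, hb⟩ := HurwitzZeta.isBigO_atTop_evenKernel_sub 0
  simp only [if_true] at hb
  have hr : (fun t => HurwitzZeta.evenKernel 0 t - 1) =O[atTop] (fun t : ℝ => t ^ r) :=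
    hb.trans (isLittleO_exp_neg_mul_rpow_atTop hp r).isBigO
  have h0 : (fun t => HurwitzZeta.evenKernel 0 t - 1) =O[atTop] (fun _ : ℝ => (1 : ℝ)) := by
    simpa using hb.trans (isLittleO_exp_neg_mul_rpow_atTop hp 0).isBigO
  have h1 : (fun t => HurwitzZeta.evenKernel 0 t + 1) =O[atTop] (fun _ : ℝ => (1 : ℝ)) := by
    refine (h0.add (Asymptotics.isBigO_const_const (2 : ℝ) one_ne_zero atTop)).congr_left ?_
    intro t; ring
  have h2 := hr.mul h1
  replace h2 := Complex.isBigO_ofReal_left.2 h2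
  refine h2.congr (fun t => ?_) (fun t => by ring)
  push_cast; ring

/-- The square of the Jacobi theta function, as data for a Mellin transform with functional
equation; used only to prove that the continuation of the lattice sum exists. -/
noncomputable def thetaSqPair : WeakFEPair ℂ where
  f := fun t => ((HurwitzZeta.evenKernel 0 t : ℝ) : ℂ) ^ 2
  g := fun t => ((HurwitzZeta.evenKernel 0 t : ℝ) : ℂ) ^ 2
  hf_int := ((continuous_ofReal.comp_continuousOn
    (HurwitzZeta.continuousOn_evenKernel 0)).pow 2).locallyIntegrableOn measurableSet_Ioi
  hg_int := ((continuous_ofReal.comp_continuousOn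
    (HurwitzZeta.continuousOn_evenKernel 0)).pow 2).locallyIntegrableOn measurableSet_Ioi
  k := 1
  hk := one_pos
  ε := 1
  hε := one_ne_zero
  f₀ := 1
  g₀ := 1
  h_feq := thetaSq_feq
  hf_top := thetaSq_top
  hg_top := thetaSq_top

theorem hasSum_thetaSq {t : ℝ} (ht : 0 < t) :
    HasSum (fun p : {p : ℤ × ℤ // p ≠ 0} =>
      (1 : ℂ) * (Real.exp (-Real.pi * ((p.1.1 : ℝ) ^ 2 + (p.1.2 : ℝ) ^ 2) * t) : ℝ))
      (((HurwitzZeta.evenKernel 0 t : ℝ) : ℂ) ^ 2 - 1) := by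
  have h := HurwitzZeta.hasSum_int_evenKernel 0 ht
  simp only [add_zero, QuotientAddGroup.mk_zero] at h
  have hm := h.summable.mul_of_nonneg h.summable (fun n => (Real.exp_pos _).le)
    (fun n => (Real.exp_pos _).le)
  have h2 := h.mul h hm
  have h3 : HasSum (fun p : ℤ × ℤ =>
      Real.exp (-Real.pi * ((p.1 : ℝ) ^ 2 + (p.2 : ℝ) ^ 2) * t))
      (HurwitzZeta.evenKernel 0 t * HurwitzZeta.evenKernel 0 t) := by
    refine h2.congr_fun fun p => ?_
    rw [← Real.exp_add]; congr 1; ring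
  have h4 := hasSum_ite_sub_hasSum h3 0
  have h5 : HasSum (fun p : {p : ℤ × ℤ // p ≠ 0} =>
      Real.exp (-Real.pi * ((p.1.1 : ℝ) ^ 2 + (p.1.2 : ℝ) ^ 2) * t))
      (HurwitzZeta.evenKernel 0 t * HurwitzZeta.evenKernel 0 t - 1) := by
    have := (hasSum_subtype_iff_indicator (s := {p : ℤ × ℤ | p ≠ 0})
      (f := fun p : ℤ × ℤ => Real.exp (-Real.pi * ((p.1 : ℝ) ^ 2 + (p.2 : ℝ) ^ 2) * t))
      (a := HurwitzZeta.evenKernel 0 t * HurwitzZeta.evenKernel 0 t - 1)).2 ?_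
    · exact this
    · convert! h4 using 1
      · funext p
        by_cases hp : p = 0
        · subst hp; simp
        · simp [hp]
      · have h0 : ((0 : ℤ × ℤ).1 : ℝ) = 0 ∧ ((0 : ℤ × ℤ).2 : ℝ) = 0 := by simp
        rw [h0.1, h0.2]; simp
  have h6 := hasSum_ofReal.2 h5
  convert h6 using 1
  · ext p; rw [one_mul]
  · push_cast; ring

theorem summable_lattice {σ : ℝ} (hσ : 1 < σ) :
    Summable (fun p : {p : ℤ × ℤ // p ≠ 0} =>
      ‖(1 : ℂ)‖ / ((p.1.1 : ℝ) ^ 2 + (p.1.2 : ℝ) ^ 2) ^ σ) := by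
  have h := EisensteinSeries.summable_one_div_norm_rpow (k := 2 * σ) (by linarith)
  have h' := ((finTwoArrowEquiv ℤ).symm.summable_iff.2 h).subtype {p : ℤ × ℤ | p ≠ 0}
  refine Summable.of_nonneg_of_le (fun p => by positivity) (fun p => ?_) h'
  obtain ⟨⟨a, b⟩, hp⟩ := p
  have hx : (![a, b] : Fin 2 → ℤ) ≠ 0 := by
    intro h0
    apply hp
    have ha := congrFun h0 0
    have hb := congrFun h0 1
    simp at ha hb
    simp [ha, hb]
  have hpos : 0 < ‖(![a, b] : Fin 2 → ℤ)‖ := norm_pos_iff.2 hx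
  have hle : ‖(![a, b] : Fin 2 → ℤ)‖ ^ 2 ≤ (a : ℝ) ^ 2 + (b : ℝ) ^ 2 := by
    have : ‖(![a, b] : Fin 2 → ℤ)‖ ≤ Real.sqrt ((a : ℝ) ^ 2 + (b : ℝ) ^ 2) := by
      rw [pi_norm_le_iff_of_nonneg (Real.sqrt_nonneg _)]
      intro i
      fin_cases i
      · simp only [Int.norm_eq_abs]
        exact Real.abs_le_sqrt (by simp; positivity)
      · simp only [Int.norm_eq_abs]
        exact Real.abs_le_sqrt (by simp; positivity)
    calc _ ≤ Real.sqrt ((a : ℝ) ^ 2 + (b : ℝ) ^ 2) ^ 2 := by gcongr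
      _ = _ := Real.sq_sqrt (by positivity)
  change ‖(1 : ℂ)‖ / ((a : ℝ) ^ 2 + (b : ℝ) ^ 2) ^ σ ≤ ‖(![a, b] : Fin 2 → ℤ)‖ ^ (-(2 * σ))
  rw [norm_one, Real.rpow_neg hpos.le, one_div, Real.rpow_mul hpos.le]
  have : ‖(![a, b] : Fin 2 → ℤ)‖ ^ (2 : ℝ) = ‖(![a, b] : Fin 2 → ℤ)‖ ^ 2 := by
    exact_mod_cast Real.rpow_natCast _ 2
  rw [this]
  gcongr

theorem exists_latticeSumContinuation : ∃ S : ℂ → ℂ, IsLatticeSumContinuation S := by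
  refine ⟨fun s => (Real.pi : ℂ) ^ s * (thetaSqPair.Λ₀ s * (Gamma s)⁻¹ - (Gamma (s + 1))⁻¹
    - 1 / (1 - s) * (Gamma s)⁻¹), ?_, ?_⟩
  · intro s hs
    have hs1 : (1 : ℂ) - s ≠ 0 := sub_ne_zero.2 (Ne.symm hs)
    apply DifferentiableAt.differentiableWithinAt
    have hpi : (Real.pi : ℂ) ≠ 0 := ofReal_ne_zero.2 Real.pi_ne_zero
    have hG : Differentiable ℂ (fun s : ℂ => (Gamma s)⁻¹) := differentiable_one_div_Gamma
    refine DifferentiableAt.mul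
      (DifferentiableAt.const_cpow differentiableAt_id (Or.inl hpi)) ?_
    refine DifferentiableAt.sub (DifferentiableAt.sub ?_ ?_) ?_
    · exact (thetaSqPair.differentiable_Λ₀ s).mul (hG s)
    · exact DifferentiableAt.comp s (f := fun z : ℂ => z + 1) (g := fun z : ℂ => (Gamma z)⁻¹)
        (hG (s + 1)) (by fun_prop)
    · exact ((differentiableAt_const _).div (by fun_prop) hs1).mul (hG s)
  · intro s hs
    have hs0 : 0 < s.re := by linarith
    have hs' : s ≠ 0 := by rintro rfl; simp at hs0
    have hG : Gamma s ≠ 0 := Gamma_ne_zero_of_re_pos hs0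
    have hpi : (Real.pi : ℂ) ≠ 0 := ofReal_ne_zero.2 Real.pi_ne_zero
    have hm := (thetaSqPair.hasMellin (s := s) (by simpa [thetaSqPair] using hs)).2
    have key := hasSum_mellin_pi_mul
      (a := fun _ : {p : ℤ × ℤ // p ≠ 0} => (1 : ℂ))
      (q := fun p : {p : ℤ × ℤ // p ≠ 0} => (p.1.1 : ℝ) ^ 2 + (p.1.2 : ℝ) ^ 2)
      (F := fun t => thetaSqPair.f t - thetaSqPair.f₀) (s := s)
      (fun p => by
        right
        obtain ⟨⟨a, b⟩, hp⟩ := p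
        by_contra hcon
        have h1 : (a : ℝ) = 0 := by
          have : (a : ℝ) ^ 2 ≤ 0 := by
            simp only at hcon; nlinarith [sq_nonneg (a : ℝ), sq_nonneg (b : ℝ)]
          exact pow_eq_zero_iff two_ne_zero |>.1 (le_antisymm this (sq_nonneg _))
        have h2 : (b : ℝ) = 0 := by
          have : (b : ℝ) ^ 2 ≤ 0 := by
            simp only at hcon; nlinarith [sq_nonneg (a : ℝ), sq_nonneg (b : ℝ)]
          exact pow_eq_zero_iff two_ne_zero |>.1 (le_antisymm this (sq_nonneg _))
        apply hp
        simp only [Int.cast_eq_zero] at h1 h2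
        simp [h1, h2])
      hs0 (fun t ht => hasSum_thetaSq ht) (summable_lattice hs)
    rw [hm] at key
    have key2 := key.mul_left ((Real.pi : ℂ) ^ s * (Gamma s)⁻¹)
    convert! key2 using 1
    · funext p
      rw [cpow_neg]
      have : (Real.pi : ℂ) ^ s ≠ 0 := by simp [cpow_eq_zero_iff, hpi]
      push_cast
      field_simp
    · simp only [WeakFEPair.Λ]
      simp only [thetaSqPair, Gamma_add_one s hs', smul_eq_mul, ofReal_one]
      field_simp

/-- The lattice sum `S₀(s)` of the square lattice, continued analytically to `ℂ ∖ {1}`, where the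
continuation is unique; `s = 1` is its pole and the value there has no meaning. -/
noncomputable def S₀ : ℂ → ℂ := Classical.choose exists_latticeSumContinuation

theorem S₀_spec : IsLatticeSumContinuation S₀ := Classical.choose_spec exists_latticeSumContinuation

/-- A nontrivial zero of `S₀`: the trivial ones are the negative integers. -/
def IsNontrivialZero (s : ℂ) : Prop := S₀ s = 0 ∧ s ≠ 1 ∧ ∀ n : ℕ, s ≠ -(n : ℂ)

/-! ### The symmetrised zeta function and the functions `𝓛` and `𝓤` -/

/-- The symmetrised zeta function `ξ₁(s) = π^(-s/2) Γ(s/2) ζ(s)`, with poles at `0` and `1` only. -/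
noncomputable def ξ₁ (s : ℂ) : ℂ := completedRiemannZeta s

/-- `𝓛(s) = s ξ₁(2s) + (1 - s) ξ₁(2s - 1)`. -/
noncomputable def L (s : ℂ) : ℂ := s * ξ₁ (2 * s) + (1 - s) * ξ₁ (2 * s - 1)

/-- `𝓤(s) = ξ₁(2s - 1) / ξ₁(2s)`. -/
noncomputable def U (s : ℂ) : ℂ := ξ₁ (2 * s - 1) / ξ₁ (2 * s)

/-! ### The MacDonald function double sums -/

/-- The MacDonald function (modified Bessel function of the second kind) `K_ν(x)`, for complex order
`ν` and `x > 0`, by its standard integral `∫₀^∞ exp(-x cosh t) cosh(ν t) dt`. -/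
noncomputable def macdonaldK (ν : ℂ) (x : ℝ) : ℂ :=
  ∫ t in Set.Ioi (0 : ℝ), (Real.exp (-x * Real.cosh t) : ℂ) * Complex.cosh (ν * t)

/-- The double sum `𝓚(n, m; s; lam)`. -/
noncomputable def K (n : ℕ) (m : ℤ) (s : ℂ) (lam : ℝ) : ℂ :=
  (Real.pi : ℂ) ^ n * ∑' p : ℕ+ × ℕ+,
    ((p.2 : ℕ) : ℂ) ^ (s - 1 / 2 + n) / ((p.1 : ℕ) : ℂ) ^ (s - 1 / 2 - n) *
      macdonaldK (s - 1 / 2 + m) (2 * Real.pi * (p.1 : ℕ) * (p.2 : ℕ) * lam)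

/-- `𝓤_𝓚(1, 1; s) = 𝓚(1, 1; s) / 𝓚(1, 1; 1 - s)` for the square lattice. -/
noncomputable def UK (s : ℂ) : ℂ := K 1 1 s 1 / K 1 1 (1 - s) 1

/-- `𝓕(s) = 𝓤_𝓚(1, 1; s) / 𝓤(s)`. -/
noncomputable def F (s : ℂ) : ℂ := UK s / U s

end SquareLattice

namespace SquareLattice

open MeasureTheory Set

/-! Write `ψ(t) = ∑_{n ≥ 1} exp(-π n² t)` and `C(s) = completedLattice s`, half of `π^(-s) Γ(s)
S₀(s)`, which is invariant under `s ↦ 1 - s`. Everything about zeros of `S₀` follows from `8 K(s) =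
s C(s) + (1 - 2s) ξ₁(2s - 1)` (`eight_mul_K`), where `K(s)` abbreviates `K 1 1 s 1`, and its
reflection `8 K(1 - s) = (1 - s) C(s) + (2s - 1) ξ₁(2s)`. Eliminating the second terms gives `8
(K(s) ξ₁(2s) + K(1 - s) ξ₁(2s - 1)) = C(s) L(s)` (`K_mul_add_K_mul`). The bracket vanishes when
`F(s) = -1`, and conversely when the denominators do not vanish; the right side vanishes exactly at
zeros of `C` or of `L`. Away from `0, 1/2, 1` the zeros of `C` are the nontrivial zeros of `S₀`
(`isNontrivialZero_iff`).

The formula for `K` comes from Mellin transforms. The substitution `t = e^u` turns each Bessel term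
into the Mellin transform of `a² exp(-π a² t - π b² / t)`, so `K(s)` is a multiple of the Mellin
transform of `∑ a² exp(-π a² t) · ψ(1/t)`, whose first factor is `-ψ'(t)/π`. The theta functional
equation makes `ψ(1/t)` affine in `ψ(t)`, and integration by parts leaves only the transforms of `ψ`
and `θ² - 1`, that is, `ξ₁` and the lattice sum. The identities hold for `Re s > 1` and extend
analytically.

That zeros of `L` lie on the critical line is a separate argument. With `Ξ(z) = z (z - 1) ξ₁(z)`,
`L(s) = 0` gives `Ξ(2s) = Ξ(2s - 1)`, whereas `|Ξ(w)| < |Ξ(w + 1)|` for `Re w > 0`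
(`norm_riemannXi_lt`). The ratio `Ξ(w) / Ξ(w + 1)` is holomorphic on the closed right half-plane
since `ζ` has no zeros with `Re ≥ 1`, has modulus one on the imaginary axis by the functional
equation and conjugation, and decays along the positive reals. Phragmén–Lindelöf bounds it by one,
given exponential growth; this requires a lower bound for `ζ` up to the line `Re = 1`, which the
3-4-1 inequality supplies. The symmetry `L(1 - s) = L(s)` handles the left half. -/

/-! ### Bounds in vertical strips and the function `Ξ`. -/

/-- `|t^(s - 1)|` depends only on `Re s` and is at most `t^(a - 1) + t^(b - 1)`, so the bound is
uniform in `Im s`. -/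
theorem norm_mellin_le_of_re_mem_Icc {E : Type*} [NormedAddCommGroup E] [NormedSpace ℂ E]
    {f : ℝ → E} {a b : ℝ} (ha : MellinConvergent f a) (hb : MellinConvergent f b) :
    ∃ C, 0 ≤ C ∧ ∀ s : ℂ, a ≤ s.re → s.re ≤ b → ‖mellin f s‖ ≤ C := by
  refine ⟨∫ t in Ioi (0 : ℝ), (‖(t : ℂ) ^ ((a : ℂ) - 1) • f t‖ + ‖(t : ℂ) ^ ((b : ℂ) - 1) • f t‖),
    by positivity, fun s hsa hsb => ?_⟩
  refine norm_integral_le_of_norm_le (ha.norm.add hb.norm) ?_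
  filter_upwards [self_mem_ae_restrict measurableSet_Ioi] with t ht
  simp only [norm_smul, ← add_mul]
  gcongr
  rw [norm_cpow_eq_rpow_re_of_pos ht, norm_cpow_eq_rpow_re_of_pos ht,
    norm_cpow_eq_rpow_re_of_pos ht]
  simp only [sub_re, ofReal_re, one_re]
  have ht' : (0 : ℝ) < t := ht
  rcases le_total 1 t with h | h
  · exact le_add_of_nonneg_of_le (by positivity) (Real.rpow_le_rpow_of_exponent_le h (by linarith))
  · exact le_add_of_le_of_nonneg (Real.rpow_le_rpow_of_exponent_ge ht h (by linarith))
      (by positivity)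

theorem norm_completedRiemannZeta₀_le (a b : ℝ) :
    ∃ C, 0 ≤ C ∧ ∀ s : ℂ, a ≤ s.re → s.re ≤ b → ‖completedRiemannZeta₀ s‖ ≤ C := by
  set P := HurwitzZeta.hurwitzEvenFEPair 0
  have hP := P.isStrongFEPair_toStrongFEPair
  obtain ⟨C, hC0, hC⟩ := norm_mellin_le_of_re_mem_Icc (hP.hasMellin ((a / 2 : ℝ) : ℂ)).1
    (hP.hasMellin ((b / 2 : ℝ) : ℂ)).1
  refine ⟨C / 2, by positivity, fun s h1 h2 => ?_⟩
  have : completedRiemannZeta₀ s = mellin P.toStrongFEPair.f (s / 2) / 2 := rfl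
  rw [this, norm_div, RCLike.norm_ofNat]
  have hre : (s / 2).re = s.re / 2 := by simp
  gcongr
  exact hC _ (by rw [hre]; linarith) (by rw [hre]; linarith)

/-- Riemann's entire function `z (z - 1) π^(-z/2) Γ(z/2) ζ(z)`. -/
noncomputable def riemannXi (z : ℂ) : ℂ := z * (z - 1) * completedRiemannZeta₀ z + 1

theorem differentiable_riemannXi : Differentiable ℂ riemannXi := by
  have := differentiable_completedZeta₀
  unfold riemannXi
  fun_prop

theorem riemannXi_one_sub (z : ℂ) : riemannXi (1 - z) = riemannXi z := by
  simp only [riemannXi, completedRiemannZeta₀_one_sub]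
  ring

theorem riemannXi_eq {z : ℂ} (h0 : z ≠ 0) (h1 : z ≠ 1) :
    riemannXi z = z * (z - 1) * completedRiemannZeta z := by
  have h2 : 1 - z ≠ 0 := sub_ne_zero.2 h1.symm
  rw [riemannXi, completedRiemannZeta_eq]
  field_simp
  ring

theorem riemannXi_eq_zeta {z : ℂ} (h0 : 0 < z.re) (h1 : z ≠ 1) :
    riemannXi z = z * (z - 1) * (Gammaℝ z * riemannZeta z) := by
  have hz : z ≠ 0 := by rintro rfl; simp at h0
  rw [riemannXi_eq hz h1, riemannZeta_def_of_ne_zero hz,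
    mul_div_cancel₀ _ (Gammaℝ_ne_zero_of_re_pos h0)]

theorem Gammaℝ_conj (z : ℂ) : Gammaℝ (starRingEnd ℂ z) = starRingEnd ℂ (Gammaℝ z) := by
  have h : (Real.pi : ℂ).arg ≠ Real.pi := by
    rw [arg_ofReal_of_nonneg Real.pi_pos.le]; exact Real.pi_pos.ne
  have h2 : starRingEnd ℂ z / 2 = starRingEnd ℂ (z / 2) := by rw [map_div₀, Complex.conj_ofNat]
  have h3 : -starRingEnd ℂ z / 2 = starRingEnd ℂ (-z / 2) := by
    rw [map_div₀, Complex.conj_ofNat, map_neg]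
  rw [Gammaℝ_def, Gammaℝ_def, map_mul, h2, h3, Gamma_conj, cpow_conj _ _ h, conj_ofReal]

/-- The functional equation sends `it` to `1 - it`, whose conjugate is `1 + it`. -/
theorem norm_riemannXi_mul_I_add_one (t : ℝ) : ‖riemannXi (t * I + 1)‖ = ‖riemannXi (t * I)‖ := by
  by_cases ht : t = 0
  · simp [ht, riemannXi]
  have h : starRingEnd ℂ (1 - t * I) = t * I + 1 := by simp [add_comm]
  have hne : (1 : ℂ) - t * I ≠ 1 := by simp [ht]
  have hne' : (t : ℂ) * I + 1 ≠ 1 := by simp [ht]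
  rw [← riemannXi_one_sub (t * I), riemannXi_eq_zeta (by simp) hne, riemannXi_eq_zeta (by simp) hne',
    ← h, Gammaℝ_conj, riemannZeta_conj]
  have h' : starRingEnd ℂ (1 - t * I) - 1 = starRingEnd ℂ (1 - t * I - 1) := by simp
  rw [h']
  simp only [norm_mul, RCLike.norm_conj]

theorem riemannXi_ne_zero {z : ℂ} (hz : 1 ≤ z.re) : riemannXi z ≠ 0 := by
  by_cases h1 : z = 1
  · simp [h1, riemannXi]
  have h0 : 0 < z.re := by linarith
  have hz0 : z ≠ 0 := by rintro rfl; simp at h0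
  rw [riemannXi_eq_zeta h0 h1]
  exact mul_ne_zero (mul_ne_zero hz0 (sub_ne_zero.2 h1))
    (mul_ne_zero (Gammaℝ_ne_zero_of_re_pos h0) (riemannZeta_ne_zero_of_one_le_re hz))

theorem norm_riemannXi_le (a b : ℝ) : ∃ C, 0 ≤ C ∧ ∀ z : ℂ, a ≤ z.re → z.re ≤ b →
    ‖riemannXi z‖ ≤ C * Real.exp ‖z‖ := by
  obtain ⟨C, hC0, hC⟩ := norm_completedRiemannZeta₀_le a b
  refine ⟨4 * C + 1, by positivity, fun z h1 h2 => ?_⟩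
  have h3 := Real.quadratic_le_exp_of_nonneg (norm_nonneg z)
  have h5 : ‖z‖ * (‖z‖ + 1) ≤ 2 * Real.exp ‖z‖ := by nlinarith [norm_nonneg z]
  have h4 : ‖z - 1‖ ≤ ‖z‖ + 1 := (norm_sub_le _ _).trans (by simp)
  calc ‖riemannXi z‖ ≤ ‖z * (z - 1) * completedRiemannZeta₀ z‖ + ‖(1 : ℂ)‖ := norm_add_le _ _
    _ = ‖z‖ * ‖z - 1‖ * ‖completedRiemannZeta₀ z‖ + 1 := by simp
    _ ≤ ‖z‖ * (‖z‖ + 1) * C + 1 := by gcongr; exact hC z h1 h2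
    _ ≤ (2 * Real.exp ‖z‖) * C + Real.exp ‖z‖ := by
      exact add_le_add (mul_le_mul_of_nonneg_right h5 hC0) (Real.one_le_exp (norm_nonneg z))
    _ ≤ _ := by nlinarith [Real.exp_pos ‖z‖, mul_nonneg hC0 (Real.exp_pos ‖z‖).le]

/-! ### Exponential upper bounds for `1/Γ`, `ζ` and `ζ'`. -/

theorem norm_sin_le_exp (z : ℂ) : ‖sin z‖ ≤ Real.exp |z.im| := by
  have h1 : ‖cexp (-z * I)‖ ≤ Real.exp |z.im| := by
    rw [norm_exp]; simpa using le_abs_self _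
  have h2 : ‖cexp (z * I)‖ ≤ Real.exp |z.im| := by
    rw [norm_exp]; simpa using neg_le_abs _
  rw [sin, norm_div, norm_mul, norm_I, RCLike.norm_ofNat]
  have := norm_sub_le (cexp (-z * I)) (cexp (z * I))
  linarith

theorem norm_Gamma_le {z : ℂ} (hz : 0 < z.re) : ‖Gamma z‖ ≤ Real.Gamma z.re := by
  rw [Gamma_eq_integral hz, Real.Gamma_eq_integral hz, GammaIntegral]
  refine norm_integral_le_of_norm_le (Real.GammaIntegral_convergent hz) ?_
  filter_upwards [self_mem_ae_restrict measurableSet_Ioi] with t ht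
  rw [norm_mul, norm_cpow_eq_rpow_re_of_pos ht, norm_real, Real.norm_of_nonneg (Real.exp_pos _).le]
  simp

/-- Reflection gives `1/Γ(z) = sin(πz) Γ(1 - z) / π`. Shifting `1 - z` to `3 - z` puts the argument
where `|Γ|` is at most `Γ` of the real part; the lower bound on `|Im z|` controls the factors `1 -
z` and `2 - z`. -/
theorem norm_inv_Gamma_le : ∃ C, 0 ≤ C ∧ ∀ z : ℂ, 1 / 4 ≤ z.re → z.re ≤ 5 / 2 → 1 / 4 ≤ |z.im| →
    ‖(Gamma z)⁻¹‖ ≤ C * Real.exp (4 * |z.im|) := by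
  obtain ⟨C, hC⟩ := (isCompact_Icc (a := (1 / 2 : ℝ)) (b := 11 / 4)).exists_bound_of_continuousOn
    (f := Real.Gamma) (fun x hx => by
      refine (Real.differentiableAt_Gamma fun m => ?_).continuousAt.continuousWithinAt
      have := hx.1
      have h : (0 : ℝ) ≤ m := m.cast_nonneg
      linarith)
  have hC0 : 0 ≤ C := (norm_nonneg _).trans (hC 1 (by norm_num))
  refine ⟨16 * C, by positivity, fun z h1 h2 h3 => ?_⟩
  have hi1 : 1 / 4 ≤ ‖1 - z‖ := h3.trans (by simpa using abs_im_le_norm (1 - z))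
  have hi2 : 1 / 4 ≤ ‖2 - z‖ := h3.trans (by simpa using abs_im_le_norm (2 - z))
  have hz1 : 1 - z ≠ 0 := by intro h; rw [h] at hi1; norm_num at hi1
  have hz2 : 2 - z ≠ 0 := by intro h; rw [h] at hi2; norm_num at hi2
  have hG : Gamma z ≠ 0 := Gamma_ne_zero_of_re_pos (by linarith)
  have e1 : Gamma (3 - z) = (2 - z) * ((1 - z) * Gamma (1 - z)) := by
    rw [← Gamma_add_one _ hz1, show 1 - z + 1 = 2 - z by ring, ← Gamma_add_one _ hz2]
    congr 1; ring
  have hpi : (Real.pi : ℂ) ≠ 0 := ofReal_ne_zero.2 Real.pi_ne_zero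
  have hsin : sin (Real.pi * z) ≠ 0 := by
    intro h
    obtain ⟨k, hk⟩ := Complex.sin_eq_zero_iff.1 h
    have : z = k := by
      have : (Real.pi : ℂ) * z = Real.pi * k := by rw [hk]; ring
      exact mul_left_cancel₀ hpi this
    rw [this] at h3
    norm_num at h3
  have e2 := Gamma_mul_Gamma_one_sub z
  have e3 : (Gamma z)⁻¹ = sin (Real.pi * z) * Gamma (3 - z) / (Real.pi * (2 - z) * (1 - z)) := by
    rw [e1]
    rw [eq_div_iff hsin] at e2
    field_simp
    linear_combination -e2
  rw [e3, norm_div, norm_mul, norm_mul, norm_mul]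
  have b1 : ‖sin (Real.pi * z)‖ ≤ Real.exp (4 * |z.im|) := by
    refine (norm_sin_le_exp _).trans (Real.exp_le_exp.2 ?_)
    rw [im_ofReal_mul, abs_mul, abs_of_pos Real.pi_pos]
    gcongr
    exact Real.pi_le_four
  have b2 : ‖Gamma (3 - z)‖ ≤ C := by
    have hre : (3 - z).re = 3 - z.re := by simp
    refine (norm_Gamma_le (by rw [hre]; linarith)).trans ((le_abs_self _).trans ?_)
    exact hC _ ⟨by rw [hre]; linarith, by rw [hre]; linarith⟩
  have b3 : (1 / 16 : ℝ) ≤ ‖(Real.pi : ℂ)‖ * ‖2 - z‖ * ‖1 - z‖ := by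
    rw [norm_real, Real.norm_of_nonneg Real.pi_pos.le]
    calc (1 / 16 : ℝ) = 1 * (1 / 4) * (1 / 4) := by norm_num
      _ ≤ _ := by gcongr; linarith [Real.pi_gt_three]
  rw [div_le_iff₀ (by linarith)]
  calc _ ≤ Real.exp (4 * |z.im|) * C := by gcongr
    _ = 16 * C * Real.exp (4 * |z.im|) * (1 / 16) := by ring
    _ ≤ _ := by gcongr

theorem norm_inv_Gammaℝ_le : ∃ C, 0 ≤ C ∧ ∀ z : ℂ, 1 / 2 ≤ z.re → z.re ≤ 5 → 1 / 2 ≤ |z.im| →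
    ‖(Gammaℝ z)⁻¹‖ ≤ C * Real.exp (2 * |z.im|) := by
  obtain ⟨C, hC0, hC⟩ := norm_inv_Gamma_le
  refine ⟨Real.pi ^ (5 / 2 : ℝ) * C, by positivity, fun z h1 h2 h3 => ?_⟩
  have hre : (z / 2).re = z.re / 2 := by simp
  have him : |(z / 2).im| = |z.im| / 2 := by simp [abs_div]
  have := hC (z / 2) (by rw [hre]; linarith) (by rw [hre]; linarith) (by rw [him]; linarith)
  rw [him, show 4 * (|z.im| / 2) = 2 * |z.im| by ring] at this
  rw [Gammaℝ_def, mul_inv, norm_mul, mul_assoc]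
  gcongr
  rw [← cpow_neg, norm_cpow_eq_rpow_re_of_pos Real.pi_pos]
  refine Real.rpow_le_rpow_of_exponent_le (by linarith [Real.pi_gt_three]) ?_
  simp
  linarith

theorem norm_zeta_le_exp : ∃ C, 0 ≤ C ∧ ∀ z : ℂ, 1 / 2 ≤ z.re → z.re ≤ 5 → 1 / 2 ≤ |z.im| →
    ‖riemannZeta z‖ ≤ Real.exp (C * |z.im|) := by
  obtain ⟨C₁, hC₁0, hC₁⟩ := norm_riemannXi_le (1 / 2) 5
  obtain ⟨C₂, hC₂0, hC₂⟩ := norm_inv_Gammaℝ_le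
  set M := 4 * C₁ * C₂ * Real.exp 5 with hM
  have hM0 : 0 ≤ M := by positivity
  refine ⟨2 * M + 3, by positivity, fun z h1 h2 h3 => ?_⟩
  have n0 : 1 / 2 ≤ ‖z‖ := h3.trans (abs_im_le_norm z)
  have n1 : 1 / 2 ≤ ‖z - 1‖ := h3.trans (by simpa using abs_im_le_norm (z - 1))
  have z0 : z ≠ 0 := norm_pos_iff.1 (by linarith)
  have z1 : z - 1 ≠ 0 := norm_pos_iff.1 (by linarith)
  have hG : Gammaℝ z ≠ 0 := Gammaℝ_ne_zero_of_re_pos (by linarith)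
  have e : riemannZeta z = riemannXi z * (Gammaℝ z)⁻¹ * (z⁻¹ * (z - 1)⁻¹) := by
    rw [riemannXi_eq_zeta (by linarith) (sub_ne_zero.1 z1)]
    field_simp
  have hz : ‖z‖ ≤ 5 + |z.im| :=
    (norm_le_abs_re_add_abs_im z).trans (by gcongr; rw [abs_of_nonneg] <;> linarith)
  have i0 : ‖z‖⁻¹ ≤ 2 := by
    rw [inv_le_comm₀ (by linarith) two_pos]; linarith
  have i1 : ‖z - 1‖⁻¹ ≤ 2 := by
    rw [inv_le_comm₀ (by linarith) two_pos]; linarith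
  calc ‖riemannZeta z‖ = ‖riemannXi z‖ * ‖(Gammaℝ z)⁻¹‖ * (‖z‖⁻¹ * ‖z - 1‖⁻¹) := by
        rw [e]; simp only [norm_mul, norm_inv]
    _ ≤ (C₁ * Real.exp (5 + |z.im|)) * (C₂ * Real.exp (2 * |z.im|)) * (2 * 2) := by
      gcongr
      · exact (hC₁ z h1 h2).trans (by gcongr)
      · exact hC₂ z h1 h2 h3
    _ = M * Real.exp (3 * |z.im|) := by
      rw [show 3 * |z.im| = |z.im| + 2 * |z.im| by ring, Real.exp_add, Real.exp_add]; ring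
    _ ≤ Real.exp (2 * M * |z.im|) * Real.exp (3 * |z.im|) := by
      gcongr
      have := Real.add_one_le_exp (2 * M * |z.im|)
      nlinarith
    _ = _ := by rw [← Real.exp_add]; ring_nf

theorem norm_deriv_zeta_le_exp : ∃ C, 0 ≤ C ∧ ∀ z : ℂ, 1 ≤ z.re → z.re ≤ 4 → 1 ≤ |z.im| →
    ‖deriv riemannZeta z‖ ≤ Real.exp (C * |z.im|) := by
  obtain ⟨C, hC0, hC⟩ := norm_zeta_le_exp
  refine ⟨2 * C + 1, by positivity, fun z h1 h2 h3 => ?_⟩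
  have him : ∀ w : ℂ, ‖w - z‖ ≤ 1 / 2 → 1 / 2 ≤ |w.im| ∧ |w.im| ≤ |z.im| + 1 / 2 := fun w hw => by
    have h := (abs_im_le_norm (w - z)).trans hw
    rw [sub_im] at h
    have h' := abs_sub_abs_le_abs_sub w.im z.im
    have h'' := abs_sub_abs_le_abs_sub z.im w.im
    rw [abs_sub_comm] at h''
    constructor <;> linarith
  have hre : ∀ w : ℂ, ‖w - z‖ ≤ 1 / 2 → 1 / 2 ≤ w.re ∧ w.re ≤ 5 := fun w hw => by
    have h := abs_le.1 ((abs_re_le_norm (w - z)).trans hw)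
    rw [sub_re] at h
    constructor <;> linarith [h.1, h.2]
  -- Cauchy's estimate on the circle of radius `1/2`, which stays within the region of the bound for
  -- `ζ` and away from the pole.
  have key := norm_deriv_le_of_forall_mem_sphere_norm_le (c := z) (R := 1 / 2) (f := riemannZeta)
    (C := Real.exp (C * (|z.im| + 1 / 2))) (by norm_num) ?_ ?_
  · refine key.trans ?_
    have h4 : (2 : ℝ) ≤ Real.exp |z.im| := by linarith [Real.add_one_le_exp |z.im|]
    calc Real.exp (C * (|z.im| + 1 / 2)) / (1 / 2) = Real.exp (C * (|z.im| + 1 / 2)) * 2 := by ring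
      _ ≤ Real.exp (C * (|z.im| + |z.im|)) * Real.exp |z.im| := by gcongr; linarith
      _ = _ := by rw [← Real.exp_add]; ring_nf
  · refine DifferentiableOn.diffContOnCl_ball (U := Metric.closedBall z (1 / 2)) (fun w hw => ?_)
      subset_rfl
    refine (differentiableAt_riemannZeta ?_).differentiableWithinAt
    rintro rfl
    have := (him 1 (by simpa [dist_eq_norm] using hw)).1
    norm_num at this
  · intro w hw
    have hw' : ‖w - z‖ ≤ 1 / 2 := by simpa [dist_eq_norm] using (Metric.mem_sphere.1 hw).le
    refine (hC w (hre w hw').1 (hre w hw').2 (him w hw').1).trans ?_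
    gcongr
    exact (him w hw').2

/-! ### Lower bound for `ζ` up to the line `Re = 1`. -/

theorem norm_zeta_one_add_le : ∃ M, 1 ≤ M ∧ ∀ x : ℝ, 0 < x → x ≤ 3 →
    ‖riemannZeta (1 + x)‖ ≤ M / x := by
  have hcont : Continuous fun x : ℝ => riemannXi (1 + x) * (Gammaℝ (1 + x))⁻¹ := by
    have h1 := differentiable_riemannXi.continuous
    have h2 := differentiable_Gammaℝ_inv.continuous
    exact (h1.comp (by fun_prop)).mul
      (h2.comp (f := fun x : ℝ => (1 : ℂ) + x) (by fun_prop))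
  obtain ⟨M, hM⟩ := (isCompact_Icc (a := (0 : ℝ)) (b := 3)).exists_bound_of_continuousOn
    hcont.continuousOn
  refine ⟨max M 1, le_max_right _ _, fun x hx0 hx3 => ?_⟩
  have h := (hM x ⟨hx0.le, hx3⟩).trans (le_max_left M 1)
  have hre : (1 + (x : ℂ)).re = 1 + x := by simp
  have hpos : 0 < (1 + (x : ℂ)).re := by rw [hre]; linarith
  have hG : Gammaℝ (1 + x) ≠ 0 := Gammaℝ_ne_zero_of_re_pos hpos
  rw [riemannXi_eq_zeta hpos (by simpa using hx0.ne')] at h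
  have e : (1 + (x : ℂ)) * (1 + x - 1) * (Gammaℝ (1 + x) * riemannZeta (1 + x)) *
      (Gammaℝ (1 + x))⁻¹ = (1 + x : ℝ) * (x * riemannZeta (1 + x)) := by
    push_cast
    field_simp
    ring
  rw [e, norm_mul, norm_mul, norm_real, norm_real, Real.norm_of_nonneg hx0.le,
    Real.norm_of_nonneg (by linarith)] at h
  rw [le_div_iff₀ hx0]
  nlinarith [mul_nonneg hx0.le (norm_nonneg (riemannZeta (1 + x)))]

/-- The inequality `|ζ(1+x)³ ζ(1+x+iy)⁴ ζ(1+x+2iy)| ≥ 1`, with the simple pole bounding the first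
factor. Writing `x = δ⁴` avoids fractional powers when the fourth root is taken. -/
theorem le_norm_zeta_near_one : ∃ C, 0 ≤ C ∧ ∀ δ y : ℝ, 0 < δ → δ ^ 4 ≤ 3 → 1 ≤ |y| →
    δ ^ 3 * Real.exp (-C * |y|) ≤ ‖riemannZeta (1 + (δ ^ 4 : ℝ) + I * y)‖ := by
  obtain ⟨M, hM1, hM⟩ := norm_zeta_one_add_le
  obtain ⟨C, hC0, hC⟩ := norm_zeta_le_exp
  refine ⟨C + M, by positivity, fun δ y hδ hδ3 hy => ?_⟩
  have hx : 0 < δ ^ 4 := by positivity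
  have key := DirichletCharacter.norm_LFunction_product_ge_one (1 : DirichletCharacter ℂ 1) hx y
  simp only [DirichletCharacter.LFunctionTrivChar, DirichletCharacter.LFunction_modOne_eq,
    norm_mul, norm_pow] at key
  set Z := ‖riemannZeta (1 + (δ ^ 4 : ℝ) + I * y)‖ with hZ
  have b1 := hM _ hx hδ3
  have hre : (1 + ((δ ^ 4 : ℝ) : ℂ) + 2 * I * y).re = 1 + δ ^ 4 := by
    simp [-ofReal_pow]
  have him : (1 + ((δ ^ 4 : ℝ) : ℂ) + 2 * I * y).im = 2 * y := by simp [-ofReal_pow]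
  have b2 := hC (1 + ((δ ^ 4 : ℝ) : ℂ) + 2 * I * y) (by rw [hre]; linarith)
    (by rw [hre]; linarith) (by rw [him, abs_mul, abs_two]; linarith)
  rw [him, abs_mul, abs_two] at b2
  have h1 : 1 ≤ (M / δ ^ 4) ^ 3 * Z ^ 4 * Real.exp (C * (2 * |y|)) :=
    le_trans key (by gcongr)
  have hMe : M ≤ Real.exp (M * |y|) := by
    have := Real.add_one_le_exp (M * |y|)
    nlinarith
  have h2 : M ^ 3 * Real.exp (C * (2 * |y|)) ≤ Real.exp ((C + M) * |y|) ^ 4 := by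
    rw [add_mul, Real.exp_add, mul_pow, mul_comm]
    have : Real.exp (C * (2 * |y|)) ≤ Real.exp (C * |y|) ^ 4 := by
      rw [← Real.exp_nat_mul]
      apply Real.exp_le_exp.2
      have : 0 ≤ C * |y| := by positivity
      push_cast; linarith
    gcongr
    calc M ^ 3 ≤ M ^ 4 := pow_le_pow_right₀ hM1 (by norm_num)
      _ ≤ _ := by gcongr
  have h3 : (δ ^ 3) ^ 4 ≤ (Z * Real.exp ((C + M) * |y|)) ^ 4 := by
    have h4 : (δ ^ 3) ^ 4 * ((M / δ ^ 4) ^ 3 * Z ^ 4 * Real.exp (C * (2 * |y|))) =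
        Z ^ 4 * (M ^ 3 * Real.exp (C * (2 * |y|))) := by
      field_simp
    calc (δ ^ 3) ^ 4 = (δ ^ 3) ^ 4 * 1 := by ring
      _ ≤ (δ ^ 3) ^ 4 * ((M / δ ^ 4) ^ 3 * Z ^ 4 * Real.exp (C * (2 * |y|))) := by gcongr
      _ ≤ Z ^ 4 * Real.exp ((C + M) * |y|) ^ 4 := by rw [h4]; gcongr
      _ = _ := by ring
  have h5 := le_of_pow_le_pow_left₀ (by norm_num) (by positivity) h3
  rw [neg_mul, Real.exp_neg, ← div_eq_mul_inv, div_le_iff₀ (Real.exp_pos _)]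
  exact h5

theorem exp_le_norm_zeta : ∃ C, 0 ≤ C ∧ ∀ z : ℂ, 1 ≤ z.re → z.re ≤ 3 → 1 ≤ |z.im| →
    Real.exp (-C * |z.im|) ≤ ‖riemannZeta z‖ := by
  obtain ⟨C, hC0, hC⟩ := le_norm_zeta_near_one
  obtain ⟨D, hD0, hD⟩ := norm_deriv_zeta_le_exp
  -- This choice makes `e^(DY) η = e^(-CY) e^(-Y)`, so moving horizontally by at most `η⁴` costs at
  -- most half of the lower bound `η³ e^(-CY)`.
  set B := D + C + 1 with hB
  refine ⟨3 * B + C + 1, by positivity, fun z h1 h2 h3 => ?_⟩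
  set Y := |z.im| with hY
  set η := Real.exp (-B * Y) with hη
  have hη0 : 0 < η := Real.exp_pos _
  have hη1 : η ≤ 1 := Real.exp_le_one_iff.2 (by nlinarith)
  have hη4 : η ^ 4 ≤ 1 := pow_le_one₀ hη0.le hη1
  have e3 : η ^ 3 = Real.exp (-(3 * B) * Y) := by
    rw [hη, ← Real.exp_nat_mul]; push_cast; ring_nf
  have hgoal : Real.exp (-(3 * B + C + 1) * Y) = η ^ 3 * (Real.exp (-C * Y) * Real.exp (-Y)) := by
    rw [e3, ← Real.exp_add, ← Real.exp_add]; ring_nf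
  have heY : Real.exp (-Y) ≤ 1 / 2 := by
    rw [Real.exp_neg, one_div]
    exact inv_anti₀ two_pos (by linarith [Real.add_one_le_exp Y])
  rw [hgoal]
  rcases le_total (η ^ 4) (z.re - 1) with h | h
  · set δ := (z.re - 1) ^ (1 / 4 : ℝ) with hδ
    have hpos : 0 < z.re - 1 := lt_of_lt_of_le (by positivity) h
    have hδ0 : 0 < δ := Real.rpow_pos_of_pos hpos _
    have hδ4 : δ ^ 4 = z.re - 1 := by
      rw [hδ, ← Real.rpow_natCast, ← Real.rpow_mul hpos.le]; norm_num
    have hle : η ≤ δ := le_of_pow_le_pow_left₀ (n := 4) (by norm_num) hδ0.le (by rw [hδ4]; exact h)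
    have key := hC δ z.im hδ0 (by rw [hδ4]; linarith) h3
    have ez : (1 + ((δ ^ 4 : ℝ) : ℂ) + I * z.im) = z := by
      rw [hδ4]; apply Complex.ext <;> simp
    rw [ez] at key
    refine le_trans ?_ key
    have : Real.exp (-C * Y) * Real.exp (-Y) ≤ Real.exp (-C * Y) :=
      mul_le_of_le_one_right (Real.exp_pos _).le (by linarith)
    gcongr
  -- Too close to the line: compare with the point `1 + η⁴` on the same horizontal line by the mean
  -- value inequality.
  · have key := hC η z.im hη0 (by linarith) h3
    set w : ℂ := 1 + ((η ^ 4 : ℝ) : ℂ) + I * z.im with hw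
    have hwre : w.re = 1 + η ^ 4 := by simp [hw, -ofReal_pow]
    have hwim : w.im = z.im := by simp [hw, -ofReal_pow]
    have hmv := Convex.norm_image_sub_le_of_norm_deriv_le (f := riemannZeta)
      (C := Real.exp (D * Y)) (x := z) (y := w) (s := Icc (1 : ℝ) 4 ×ℂ {z.im}) ?_ ?_ ?_ ?_ ?_
    · have hwz : ‖w - z‖ ≤ η ^ 4 := by
        have : w - z = ((1 + η ^ 4 - z.re : ℝ) : ℂ) := by
          apply Complex.ext
          · rw [sub_re, hwre, ofReal_re]
          · rw [sub_im, hwim, ofReal_im, sub_self]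
        rw [this, norm_real, Real.norm_of_nonneg (by linarith)]
        linarith
      have h6 : ‖riemannZeta w‖ - ‖riemannZeta z‖ ≤ Real.exp (D * Y) * η ^ 4 :=
        (norm_sub_norm_le _ _).trans (hmv.trans (by gcongr))
      have e4 : Real.exp (D * Y) * η ^ 4 = η ^ 3 * (Real.exp (-C * Y) * Real.exp (-Y)) := by
        rw [pow_succ, ← mul_assoc, mul_comm _ (η ^ 3), mul_assoc, hη, ← Real.exp_add,
          ← Real.exp_add, hB]
        ring_nf
      have h7 : η ^ 3 * (Real.exp (-C * Y) * Real.exp (-Y)) ≤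
          η ^ 3 * (Real.exp (-C * Y) * (1 / 2)) := by gcongr
      change η ^ 3 * Real.exp (-C * Y) ≤ _ at key
      linarith
    · rintro u ⟨-, hu⟩
      refine differentiableAt_riemannZeta ?_
      rintro rfl
      have : (1 : ℂ).im = z.im := hu
      rw [hY, ← this] at h3
      norm_num at h3
    · rintro u ⟨⟨hu1, hu2⟩, hu⟩
      have : u.im = z.im := hu
      rw [hY, ← this]
      exact hD u hu1 hu2 (by rw [this]; exact h3)
    · exact ((convex_Icc (1 : ℝ) 4).linear_preimage reLm).inter
        ((convex_singleton z.im).linear_preimage imLm)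
    · exact ⟨⟨h1, by linarith⟩, rfl⟩
    · refine ⟨⟨?_, ?_⟩, hwim⟩
      · rw [hwre]; linarith [pow_pos hη0 4]
      · rw [hwre]; linarith

/-! ### Decay of `Ξ(w) / Ξ(w + 1)` to the right. -/

theorem norm_betaIntegral_le {u : ℂ} {v : ℝ} :
    ‖betaIntegral u v‖ ≤ ‖betaIntegral u.re v‖ := by
  have h1 : ∀ x ∈ Ioo (0 : ℝ) 1, ((‖(x : ℂ) ^ (u - 1) * (1 - (x : ℂ)) ^ ((v : ℂ) - 1)‖ : ℝ) : ℂ) =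
      (x : ℂ) ^ ((u.re : ℂ) - 1) * (1 - (x : ℂ)) ^ ((v : ℂ) - 1) := by
    rintro x ⟨hx0, hx1⟩
    have e : (1 : ℂ) - x = ((1 - x : ℝ) : ℂ) := by push_cast; rfl
    rw [norm_mul, e, norm_cpow_eq_rpow_re_of_pos hx0, norm_cpow_eq_rpow_re_of_pos (by linarith),
      ofReal_mul, ofReal_cpow hx0.le, ofReal_cpow (by linarith)]
    simp
  have h2 : betaIntegral u.re v =
      ((∫ x in (0 : ℝ)..1, ‖(x : ℂ) ^ (u - 1) * (1 - (x : ℂ)) ^ ((v : ℂ) - 1)‖ : ℝ) : ℂ) := by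
    rw [betaIntegral, ← intervalIntegral.integral_ofReal, intervalIntegral.integral_of_le zero_le_one,
      intervalIntegral.integral_of_le zero_le_one, integral_Ioc_eq_integral_Ioo,
      integral_Ioc_eq_integral_Ioo]
    exact (setIntegral_congr_fun measurableSet_Ioo h1).symm
  rw [h2, norm_real]
  exact (intervalIntegral.norm_integral_le_integral_norm zero_le_one).trans (le_abs_self _)

/-- Log-convexity gives `Γ(x)² ≤ Γ(x - 1/2) Γ(x + 1/2)`; the factor `x - 1/2` raises the first
argument by one. -/
theorem sq_Gamma_le {x : ℝ} (hx : 1 / 2 < x) :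
    (x - 1 / 2) * Real.Gamma x ^ 2 ≤ Real.Gamma (x + 1 / 2) ^ 2 := by
  have h1 : 0 < x - 1 / 2 := by linarith
  have h := Real.Gamma_mul_add_mul_le_rpow_Gamma_mul_rpow_Gamma (s := x - 1 / 2) (t := x + 1 / 2)
    (a := 1 / 2) (b := 1 / 2) h1 (by linarith) (by norm_num) (by norm_num) (by norm_num)
  have p1 := Real.Gamma_pos_of_pos h1
  have p2 := Real.Gamma_pos_of_pos (show 0 < x + 1 / 2 by linarith)
  have p3 := Real.Gamma_pos_of_pos (show 0 < x by linarith)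
  rw [show 1 / 2 * (x - 1 / 2) + 1 / 2 * (x + 1 / 2) = x by ring, ← Real.sqrt_eq_rpow,
    ← Real.sqrt_eq_rpow, ← Real.sqrt_mul p1.le] at h
  have h3 := Real.Gamma_add_one h1.ne'
  rw [show x - 1 / 2 + 1 = x + 1 / 2 by ring] at h3
  have h4 : Real.Gamma x ^ 2 ≤ Real.Gamma (x - 1 / 2) * Real.Gamma (x + 1 / 2) :=
    (Real.le_sqrt p3.le (by positivity)).1 h
  calc _ ≤ (x - 1 / 2) * (Real.Gamma (x - 1 / 2) * Real.Gamma (x + 1 / 2)) := by gcongr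
    _ = _ := by rw [← mul_assoc, ← h3]; ring

/-- Since `Γ(u) Γ(1/2) = Γ(u + 1/2) B(u, 1/2)` and `|B(u, 1/2)| ≤ B(Re u, 1/2)`, the ratio `|Γ(u) /
Γ(u + 1/2)|` is largest at the real point, where the real estimate applies. -/
theorem sq_norm_Gamma_le {u : ℂ} (hu : 1 / 2 < u.re) :
    (u.re - 1 / 2) * ‖Gamma u‖ ^ 2 ≤ ‖Gamma (u + 1 / 2)‖ ^ 2 := by
  have hu0 : 0 < u.re := by linarith
  have hv : 0 < (((1 / 2 : ℝ) : ℝ) : ℂ).re := by rw [ofReal_re]; norm_num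
  have e1 := Gamma_mul_Gamma_eq_betaIntegral hu0 hv
  have e2 := Gamma_mul_Gamma_eq_betaIntegral (s := (u.re : ℂ)) (by simpa using hu0) hv
  rw [← ofReal_add, Gamma_ofReal, Gamma_ofReal] at e2
  have p3 := Real.Gamma_pos_of_pos (show 0 < u.re by linarith)
  have p4 := Real.Gamma_pos_of_pos (show 0 < u.re + 1 / 2 by linarith)
  have p5 : 0 < ‖Gamma ((1 / 2 : ℝ) : ℂ)‖ := norm_pos_iff.2 (Gamma_ne_zero_of_re_pos hv)
  have f1 := congrArg norm e1
  have f2 := congrArg norm e2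
  have hb := norm_betaIntegral_le (u := u) (v := 1 / 2)
  simp only [norm_mul, norm_real, Real.norm_of_nonneg p3.le] at f1 f2
  have f2' : Real.Gamma u.re * ‖Gamma ((1 / 2 : ℝ) : ℂ)‖ =
      Real.Gamma (u.re + 1 / 2) * ‖betaIntegral u.re ((1 / 2 : ℝ) : ℂ)‖ := by
    rw [Complex.Gamma_ofReal, norm_real, f2, Complex.Gamma_ofReal, norm_real,
      Real.norm_of_nonneg p4.le]
  have e3 : u + ((1 / 2 : ℝ) : ℂ) = u + 1 / 2 := by push_cast; rfl
  rw [e3] at f1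
  have h6 : ‖Gamma u‖ * Real.Gamma (u.re + 1 / 2) ≤ ‖Gamma (u + 1 / 2)‖ * Real.Gamma u.re := by
    refine le_of_mul_le_mul_right ?_ p5
    calc _ = ‖Gamma (u + 1 / 2)‖ * ‖betaIntegral u ((1 / 2 : ℝ) : ℂ)‖ * Real.Gamma (u.re + 1 / 2) :=
          by rw [← f1]; ring
      _ ≤ ‖Gamma (u + 1 / 2)‖ * ‖betaIntegral u.re ((1 / 2 : ℝ) : ℂ)‖ *
          Real.Gamma (u.re + 1 / 2) := by gcongr
      _ = ‖Gamma (u + 1 / 2)‖ * (Real.Gamma u.re * ‖Gamma ((1 / 2 : ℝ) : ℂ)‖) := by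
          rw [f2']; ring
      _ = _ := by ring
  have h7 := sq_Gamma_le hu
  have h8 : 0 < u.re - 1 / 2 := by linarith
  refine le_of_mul_le_mul_right ?_ (pow_pos p3 2)
  calc _ = ((u.re - 1 / 2) * Real.Gamma u.re ^ 2) * ‖Gamma u‖ ^ 2 := by ring
    _ ≤ Real.Gamma (u.re + 1 / 2) ^ 2 * ‖Gamma u‖ ^ 2 := by gcongr
    _ = (‖Gamma u‖ * Real.Gamma (u.re + 1 / 2)) ^ 2 := by ring
    _ ≤ (‖Gamma (u + 1 / 2)‖ * Real.Gamma u.re) ^ 2 := by gcongr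
    _ = _ := by ring

/-- The tail is dominated by `∑_{n ≥ 2} n⁻² = π²/6 - 1 < 13/20`. A constant below one keeps `ζ` away
from zero. -/
theorem norm_zeta_sub_one_le {z : ℂ} (hz : 2 ≤ z.re) : ‖riemannZeta z - 1‖ ≤ 13 / 20 := by
  have h2 := hasSum_zeta_two
  have hs : Summable fun n : ℕ => 1 / ((n : ℂ) + 1) ^ z := by
    have := (Complex.summable_one_div_nat_cpow (p := z)).2 (by linarith)
    simpa using (summable_nat_add_iff 1).2 this
  have h2' : HasSum (fun n : ℕ => 1 / ((n : ℝ) + 2) ^ 2) (Real.pi ^ 2 / 6 - 1) := by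
    have := (hasSum_nat_add_iff' 2).2 h2
    simpa [Finset.sum_range_succ] using this
  rw [zeta_eq_tsum_one_div_nat_add_one_cpow (by linarith), hs.tsum_eq_zero_add]
  simp only [Nat.cast_zero, zero_add, one_cpow, div_one, add_sub_cancel_left]
  refine (tsum_of_norm_bounded h2' fun n => ?_).trans ?_
  · have e : ((n + 1 : ℕ) : ℂ) + 1 = ((n + 2 : ℝ) : ℂ) := by push_cast; ring
    have hn : (0 : ℝ) < n + 2 := by positivity
    rw [e, norm_div, norm_one, norm_cpow_eq_rpow_re_of_pos hn, ← Real.rpow_two]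
    have h1 : (1 : ℝ) ≤ n + 2 := by linarith [(n.cast_nonneg : (0 : ℝ) ≤ n)]
    gcongr
  · nlinarith [Real.pi_lt_d4, Real.pi_gt_three]

/-- The Gamma ratio supplies the decay. The constant is `200 = 8 · 5²`: `8` from the Gamma factors
and `5` from `33/20 ≤ 5 · 7/20` for the zeta factors. -/
theorem norm_riemannXi_div_le {w : ℂ} (hw : 2 ≤ w.re) :
    ‖riemannXi w / riemannXi (w + 1)‖ ^ 2 ≤ 200 / (w.re - 1) := by
  have w0 : w ≠ 0 := by rintro rfl; norm_num at hw
  have w1 : w ≠ 1 := by rintro rfl; norm_num at hw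
  have hre : (w + 1).re = w.re + 1 := by simp
  have w2 : w + 1 ≠ 1 := by simpa using w0
  have z1 := norm_zeta_sub_one_le hw
  have z2 := norm_zeta_sub_one_le (z := w + 1) (by rw [hre]; linarith)
  have z3 : ‖riemannZeta w‖ ≤ 33 / 20 := by
    have := norm_sub_norm_le (riemannZeta w) 1
    rw [norm_one] at this; linarith
  have z4 : 7 / 20 ≤ ‖riemannZeta (w + 1)‖ := by
    have := norm_sub_norm_le 1 (riemannZeta (w + 1))
    rw [norm_one, norm_sub_rev] at this; linarith
  have hG := sq_norm_Gamma_le (u := w / 2) (by simp; linarith)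
  have hre2 : (w / 2).re = w.re / 2 := by simp
  rw [hre2] at hG
  have p1 : ‖(Real.pi : ℂ) ^ (-w / 2)‖ = Real.pi ^ (1 / 2 : ℝ) * ‖(Real.pi : ℂ) ^ (-(w + 1) / 2)‖ := by
    rw [norm_cpow_eq_rpow_re_of_pos Real.pi_pos, norm_cpow_eq_rpow_re_of_pos Real.pi_pos,
      ← Real.rpow_add Real.pi_pos]
    congr 1
    simp
    ring
  have hsq : (Real.pi ^ (1 / 2 : ℝ)) ^ 2 ≤ 4 := by
    rw [← Real.sqrt_eq_rpow, Real.sq_sqrt Real.pi_pos.le]; exact Real.pi_le_four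
  have hR : (w.re - 1) * ‖Gammaℝ w‖ ^ 2 ≤ 8 * ‖Gammaℝ (w + 1)‖ ^ 2 := by
    rw [Gammaℝ_def, Gammaℝ_def, norm_mul, norm_mul, p1, show (w + 1) / 2 = w / 2 + 1 / 2 by ring]
    set P := ‖(Real.pi : ℂ) ^ (-(w + 1) / 2)‖
    calc _ = 2 * (Real.pi ^ (1 / 2 : ℝ)) ^ 2 * P ^ 2 * ((w.re / 2 - 1 / 2) * ‖Gamma (w / 2)‖ ^ 2) :=
          by ring
      _ ≤ 2 * (Real.pi ^ (1 / 2 : ℝ)) ^ 2 * P ^ 2 * ‖Gamma (w / 2 + 1 / 2)‖ ^ 2 := by gcongr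
      _ ≤ 2 * 4 * P ^ 2 * ‖Gamma (w / 2 + 1 / 2)‖ ^ 2 := by gcongr
      _ = _ := by ring
  have hw1 : ‖w - 1‖ ≤ ‖w + 1‖ := by
    rw [Complex.norm_def, Complex.norm_def]
    apply Real.sqrt_le_sqrt
    simp only [normSq_apply, sub_re, add_re, one_re, sub_im, add_im, one_im]
    nlinarith
  rw [norm_div, div_pow, div_le_div_iff₀ _ (by linarith)]
  · rw [riemannXi_eq_zeta (by linarith) w1, riemannXi_eq_zeta (by rw [hre]; linarith) w2,
      add_sub_cancel_right]
    simp only [norm_mul, mul_pow]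
    calc _ = (‖w‖ ^ 2 * ‖w - 1‖ ^ 2) * ((w.re - 1) * ‖Gammaℝ w‖ ^ 2) * ‖riemannZeta w‖ ^ 2 := by ring
      _ ≤ (‖w‖ ^ 2 * ‖w - 1‖ ^ 2) * (8 * ‖Gammaℝ (w + 1)‖ ^ 2) * ‖riemannZeta w‖ ^ 2 := by gcongr
      _ ≤ (‖w‖ ^ 2 * ‖w + 1‖ ^ 2) * (8 * ‖Gammaℝ (w + 1)‖ ^ 2) * (5 * ‖riemannZeta (w + 1)‖) ^ 2 := by
        gcongr
        linarith
      _ = _ := by ring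
  · have : riemannXi (w + 1) ≠ 0 := riemannXi_ne_zero (by rw [hre]; linarith)
    positivity

/-! ### Phragmén–Lindelöf for `Ξ(w) / Ξ(w + 1)`. -/

theorem exp_le_norm_riemannXi_add_one : ∃ C, 0 ≤ C ∧ ∀ w : ℂ, 0 ≤ w.re → w.re ≤ 2 → 1 ≤ |w.im| →
    Real.exp (-C * ‖w‖) ≤ ‖riemannXi (w + 1)‖ := by
  obtain ⟨C, hC0, hC⟩ := norm_inv_Gammaℝ_le
  obtain ⟨D, hD0, hD⟩ := exp_le_norm_zeta
  refine ⟨C + 2 + D, by positivity, fun w h1 h2 h3 => ?_⟩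
  have hre : (w + 1).re = w.re + 1 := by simp
  have him : (w + 1).im = w.im := by simp
  have w1 : 1 ≤ ‖w‖ := h3.trans (abs_im_le_norm w)
  have w2 : 1 ≤ ‖w + 1‖ := h3.trans (by simpa using abs_im_le_norm (w + 1))
  have hw : w + 1 ≠ 1 := by
    intro h; rw [add_eq_right] at h; rw [h] at w1; norm_num at w1
  have b1 := hC (w + 1) (by rw [hre]; linarith) (by rw [hre]; linarith) (by rw [him]; linarith)
  have b2 := hD (w + 1) (by rw [hre]; linarith) (by rw [hre]; linarith) (by rw [him]; exact h3)
  rw [him] at b1 b2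
  have hG : 0 < ‖Gammaℝ (w + 1)‖ :=
    norm_pos_iff.2 (Gammaℝ_ne_zero_of_re_pos (by rw [hre]; linarith))
  have hCe : C ≤ Real.exp (C * |w.im|) := by
    have := Real.add_one_le_exp (C * |w.im|)
    nlinarith
  have b3 : Real.exp (-(C + 2) * |w.im|) ≤ ‖Gammaℝ (w + 1)‖ := by
    rw [neg_mul, Real.exp_neg]
    refine inv_le_of_inv_le₀ hG ?_
    rw [← norm_inv]
    refine b1.trans ?_
    rw [add_mul, Real.exp_add]
    gcongr
  rw [riemannXi_eq_zeta (by rw [hre]; linarith) hw, add_sub_cancel_right]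
  simp only [norm_mul]
  calc Real.exp (-(C + 2 + D) * ‖w‖) ≤ Real.exp (-(C + 2 + D) * |w.im|) := by
        apply Real.exp_le_exp.2
        have := mul_le_mul_of_nonneg_left (abs_im_le_norm w) (show 0 ≤ C + 2 + D by positivity)
        linarith
    _ = 1 * 1 * (Real.exp (-(C + 2) * |w.im|) * Real.exp (-D * |w.im|)) := by
        rw [← Real.exp_add]; ring_nf
    _ ≤ _ := by gcongr

theorem differentiableAt_riemannXi_div {z : ℂ} (hz : 0 ≤ z.re) :
    DifferentiableAt ℂ (fun w => riemannXi w / riemannXi (w + 1)) z := by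
  have hd := differentiable_riemannXi
  have h1 : DifferentiableAt ℂ (fun w => riemannXi (w + 1)) z :=
    (hd (z + 1)).comp z (f := fun w => w + 1) (by fun_prop)
  exact (hd z).fun_div h1 (riemannXi_ne_zero (by simpa using hz))

theorem norm_riemannXi_div_le_one {w : ℂ} (hw : 0 ≤ w.re) :
    ‖riemannXi w / riemannXi (w + 1)‖ ≤ 1 := by
  refine PhragmenLindelof.right_half_plane_of_tendsto_zero_on_real
    (f := fun w => riemannXi w / riemannXi (w + 1)) ?_ ?_ ?_ ?_ hw
  · refine DifferentiableOn.diffContOnCl fun z hz => ?_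
    rw [closure_setOfPred_lt_re] at hz
    exact (differentiableAt_riemannXi_div hz).differentiableWithinAt
  · obtain ⟨C, hC0, hC⟩ := exp_le_norm_riemannXi_add_one
    obtain ⟨D, hD0, hD⟩ := norm_riemannXi_le 0 2
    refine ⟨1, by norm_num, 1 + C, Asymptotics.IsBigO.of_bound (D + 200) ?_⟩
    -- Outside the disc of radius `4`, a point with `0 < Re z ≤ 2` has `|Im z| ≥ 1`, as the strip
    -- bound needs.
    filter_upwards [mem_inf_of_left (eventually_cobounded_le_norm (4 : ℝ)),
      mem_inf_of_right (mem_principal_self _)] with z hz hz0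
    have hz0' : 0 < z.re := hz0
    rw [Real.rpow_one, Real.norm_of_nonneg (Real.exp_pos _).le]
    have he : 1 ≤ Real.exp ((1 + C) * ‖z‖) := Real.one_le_exp (by positivity)
    rcases le_total 2 z.re with h | h
    · have h1 := norm_riemannXi_div_le h
      have h2 : 200 / (z.re - 1) ≤ 200 := div_le_self (by norm_num) (by linarith)
      have h3 : ‖riemannXi z / riemannXi (z + 1)‖ ≤ 200 := by nlinarith
      nlinarith
    · have him : 1 ≤ |z.im| := by
        have := norm_le_abs_re_add_abs_im z
        rw [abs_of_pos hz0'] at this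
        linarith
      have h1 := hC z hz0'.le h him
      have h2 := hD z hz0'.le h
      rw [norm_div, div_le_iff₀ (lt_of_lt_of_le (Real.exp_pos _) h1)]
      calc ‖riemannXi z‖ ≤ D * Real.exp ‖z‖ := h2
        _ = D * Real.exp ((1 + C) * ‖z‖) * Real.exp (-C * ‖z‖) := by
          rw [mul_assoc, ← Real.exp_add]; ring_nf
        _ ≤ (D + 200) * Real.exp ((1 + C) * ‖z‖) * ‖riemannXi (z + 1)‖ := by gcongr; linarith
  · rw [tendsto_zero_iff_norm_tendsto_zero]
    have h1 : Tendsto (fun x : ℝ => ‖riemannXi x / riemannXi (x + 1)‖ ^ 2) atTop (𝓝 0) := by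
      refine squeeze_zero' (Eventually.of_forall fun x => by positivity)
        ((eventually_ge_atTop 2).mono fun x hx => norm_riemannXi_div_le (w := x) (by simpa using hx)) ?_
      simp only [ofReal_re]
      exact Tendsto.const_div_atTop (tendsto_atTop_add_const_right _ (-1) tendsto_id) _
    have h2 := (Real.continuous_sqrt.tendsto 0).comp h1
    simp only [Function.comp_def, Real.sqrt_sq (norm_nonneg _), Real.sqrt_zero] at h2
    exact h2
  · intro x
    have h := norm_riemannXi_mul_I_add_one x
    rw [norm_div, h]
    exact div_self_le_one _

/-- Strictness is the maximum principle: equality at one point would force modulus one throughout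
the half-plane, against the decay on the real axis. -/
theorem norm_riemannXi_lt {w : ℂ} (hw : 0 < w.re) : ‖riemannXi w‖ < ‖riemannXi (w + 1)‖ := by
  have hpos : 0 < ‖riemannXi (w + 1)‖ := norm_pos_iff.2 (riemannXi_ne_zero (by simpa using hw.le))
  rw [← div_lt_one hpos, ← norm_div]
  refine lt_of_le_of_ne (norm_riemannXi_div_le_one hw.le) fun h1 => ?_
  set f : ℂ → ℂ := fun w => riemannXi w / riemannXi (w + 1) with hf
  have hD : DifferentiableOn ℂ f {z | 0 < z.re} :=
    fun z hz => (differentiableAt_riemannXi_div (le_of_lt hz)).differentiableWithinAt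
  have hmax : IsMaxOn (norm ∘ f) {z | 0 < z.re} w := fun z hz => by
    change ‖f z‖ ≤ ‖f w‖
    rw [hf, h1]
    exact norm_riemannXi_div_le_one (le_of_lt hz)
  have key := Complex.norm_eqOn_of_isPreconnected_of_isMaxOn
    (convex_halfSpace_re_gt 0).isPreconnected (isOpen_lt continuous_const continuous_re) hD
    (c := w) hw hmax
  -- Any real point beyond `201` would do, since there `200 / (x - 1) < 1`.
  have h2 : ((1000 : ℝ) : ℂ) ∈ {z : ℂ | 0 < z.re} := by
    rw [mem_ofPred_eq, ofReal_re]; norm_num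
  have h3 : ‖f ((1000 : ℝ) : ℂ)‖ = ‖f w‖ := key h2
  have h4 : ‖f ((1000 : ℝ) : ℂ)‖ ^ 2 ≤ _ :=
    norm_riemannXi_div_le (w := ((1000 : ℝ) : ℂ)) (by rw [ofReal_re]; norm_num)
  rw [h3, hf, h1, ofReal_re] at h4
  norm_num at h4

/-! ### Zeros of `L`. -/

theorem L_eq_riemannXi {s : ℂ} (h0 : s ≠ 0) (h1 : s ≠ 1 / 2) (h2 : s ≠ 1) :
    2 * (2 * s - 1) * L s = riemannXi (2 * s) - riemannXi (2 * s - 1) := by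
  have a1 : 2 * s ≠ 0 := mul_ne_zero two_ne_zero h0
  have a2 : 2 * s ≠ 1 := fun h => h1 (by linear_combination h / 2)
  have a3 : 2 * s - 1 ≠ 0 := sub_ne_zero.2 a2
  have a4 : 2 * s - 1 ≠ 1 := fun h => h2 (by linear_combination h / 2)
  rw [riemannXi_eq a1 a2, riemannXi_eq a3 a4, L, ξ₁, ξ₁]
  ring

theorem ξ₁_two_mul_one_sub (s : ℂ) : ξ₁ (2 * (1 - s)) = ξ₁ (2 * s - 1) := by
  rw [ξ₁, ξ₁, ← completedRiemannZeta_one_sub]; ring_nf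

theorem ξ₁_two_mul_one_sub_sub_one (s : ℂ) : ξ₁ (2 * (1 - s) - 1) = ξ₁ (2 * s) := by
  rw [ξ₁, ξ₁, ← completedRiemannZeta_one_sub]; ring_nf

theorem L_one_sub (s : ℂ) : L (1 - s) = L s := by
  rw [L, L, ξ₁_two_mul_one_sub, ξ₁_two_mul_one_sub_sub_one]; ring

theorem L_ne_zero_of_half_lt_re {s : ℂ} (hs : 1 / 2 < s.re) (h2 : s ≠ 1) : L s ≠ 0 := by
  intro hL
  have h0 : s ≠ 0 := by rintro rfl; norm_num at hs
  have h1 : s ≠ 1 / 2 := by rintro rfl; norm_num at hs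
  have h := L_eq_riemannXi h0 h1 h2
  rw [hL, mul_zero] at h
  have h3 := norm_riemannXi_lt (w := 2 * s - 1) (by simp; linarith)
  rw [sub_add_cancel, ← sub_eq_zero.1 h.symm] at h3
  exact lt_irrefl _ h3

theorem re_eq_half_of_L_eq_zero {s : ℂ} (h0 : s ≠ 0) (h2 : s ≠ 1) (hL : L s = 0) :
    s.re = 1 / 2 := by
  rcases lt_trichotomy s.re (1 / 2) with h | h | h
  · refine absurd (L_one_sub s ▸ hL) (L_ne_zero_of_half_lt_re (s := 1 - s) (by simp; linarith) ?_)
    simpa using h0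
  · exact h
  · exact absurd hL (L_ne_zero_of_half_lt_re h h2)

/-! ### Theta-type series and domination at both ends of `(0, ∞)`. -/

/-- The theta-type series `∑ n ≥ 1, n^(2k) exp(-π n² t)`. -/
noncomputable def thetaSum (k : ℕ) (t : ℝ) : ℝ :=
  ∑' n : ℕ+, ((n : ℝ) ^ 2) ^ k * Real.exp (-Real.pi * (n : ℝ) ^ 2 * t)

theorem summable_thetaSum (k : ℕ) {t : ℝ} (ht : 0 < t) :
    Summable fun n : ℕ+ => ((n : ℝ) ^ 2) ^ k * Real.exp (-Real.pi * (n : ℝ) ^ 2 * t) := by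
  have h := (Real.summable_pow_mul_exp_neg_nat_mul (2 * k) (r := Real.pi * t)
    (by positivity)).comp_injective PNat.coe_injective
  refine Summable.of_nonneg_of_le (fun n => by positivity) (fun n => ?_) h
  simp only [Function.comp_apply, ← pow_mul]
  have hn : (1 : ℝ) ≤ n := Nat.one_le_cast.2 n.2
  have : Real.pi * t * n ≤ Real.pi * t * (n : ℝ) ^ 2 := by gcongr; nlinarith
  refine mul_le_mul_of_nonneg_left (Real.exp_le_exp.2 ?_) (by positivity)
  linarith

theorem thetaSum_nonneg (k : ℕ) (t : ℝ) : 0 ≤ thetaSum k t := tsum_nonneg fun n => by positivity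

theorem thetaSum_zero_le (t : ℝ) (ht : 0 < t) : thetaSum 0 t ≤ thetaSum 1 t := by
  refine (summable_thetaSum 0 ht).tsum_le_tsum (fun n => ?_) (summable_thetaSum 1 ht)
  have hn : (1 : ℝ) ≤ n := Nat.one_le_cast.2 n.2
  have : 1 ≤ (n : ℝ) ^ 2 := by nlinarith
  rw [pow_zero, pow_one]
  gcongr

theorem hasDerivAt_thetaSum (k : ℕ) {t : ℝ} (ht : 0 < t) :
    HasDerivAt (thetaSum k) (-Real.pi * thetaSum (k + 1) t) t := by
  have h2 : 0 < t / 2 := by positivity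
  have key := hasDerivAt_tsum_of_isPreconnected
    (u := fun n : ℕ+ => Real.pi * (((n : ℝ) ^ 2) ^ (k + 1) *
      Real.exp (-Real.pi * (n : ℝ) ^ 2 * (t / 2))))
    (g := fun (n : ℕ+) (t : ℝ) => ((n : ℝ) ^ 2) ^ k * Real.exp (-Real.pi * (n : ℝ) ^ 2 * t))
    (g' := fun (n : ℕ+) (t : ℝ) => -Real.pi * (((n : ℝ) ^ 2) ^ (k + 1) *
      Real.exp (-Real.pi * (n : ℝ) ^ 2 * t))) (t := Ioi (t / 2)) (y₀ := t) (y := t)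
    ((summable_thetaSum (k + 1) h2).mul_left _) isOpen_Ioi isPreconnected_Ioi
    (fun n y hy => ?_) (fun n y hy => ?_) (by simpa using ht) (summable_thetaSum k ht)
    (by simpa using ht)
  · rwa [tsum_mul_left] at key
  · have := (((hasDerivAt_id y).const_mul (-Real.pi * (n : ℝ) ^ 2)).exp).const_mul
      (((n : ℝ) ^ 2) ^ k)
    refine this.congr_deriv ?_
    simp only [id]
    ring
  · have hy' : t / 2 < y := hy
    rw [norm_mul, norm_neg, Real.norm_of_nonneg Real.pi_pos.le, Real.norm_of_nonneg (by positivity)]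
    have : Real.pi * (n : ℝ) ^ 2 * (t / 2) ≤ Real.pi * (n : ℝ) ^ 2 * y := by gcongr
    refine mul_le_mul_of_nonneg_left (mul_le_mul_of_nonneg_left (Real.exp_le_exp.2 ?_)
      (by positivity)) Real.pi_pos.le
    linarith

theorem continuousOn_thetaSum (k : ℕ) : ContinuousOn (thetaSum k) (Ioi 0) :=
  fun _ ht => (hasDerivAt_thetaSum k ht).continuousAt.continuousWithinAt

theorem evenKernel_zero_eq {t : ℝ} (ht : 0 < t) :
    HurwitzZeta.evenKernel 0 t = 1 + 2 * thetaSum 0 t := by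
  have h := HurwitzZeta.hasSum_int_evenKernel 0 ht
  simp only [add_zero, QuotientAddGroup.mk_zero] at h
  rw [← h.tsum_eq, tsum_int_eq_zero_add_two_mul_tsum_pnat _ h.summable]
  · simp [thetaSum]
  · intro n; simp

theorem thetaSum_zero_inv {t : ℝ} (ht : 0 < t) :
    thetaSum 0 t⁻¹ = √t * thetaSum 0 t + (√t - 1) / 2 := by
  have h := HurwitzZeta.evenKernel_functional_equation 0 t
  rw [← HurwitzZeta.evenKernel_eq_cosKernel_of_zero, evenKernel_zero_eq ht, one_div t,
    evenKernel_zero_eq (inv_pos.2 ht), ← Real.sqrt_eq_rpow] at h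
  have := Real.sqrt_pos.2 ht
  field_simp at h
  rw [one_div] at h
  linarith

/-- The quantity `a² t + b² / t` is at least `2ab ≥ a + b` and also at least `t + 1/t`; averaging
separates decay in `a`, `b` from decay in `t`. -/
theorem exp_add_le {t a b : ℝ} (ht : 0 < t) (ha : 1 ≤ a) (hb : 1 ≤ b) :
    Real.exp (-Real.pi * a ^ 2 * t) * Real.exp (-Real.pi * b ^ 2 * t⁻¹) ≤
      Real.exp (-(Real.pi / 2) * a) * Real.exp (-(Real.pi / 2) * b) *
        Real.exp (-(Real.pi / 2) * (t + t⁻¹)) := by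
  rw [← Real.exp_add, ← Real.exp_add, ← Real.exp_add]
  apply Real.exp_le_exp.2
  have hti : 0 < t⁻¹ := inv_pos.2 ht
  have h1 : 2 * (a * b) ≤ a ^ 2 * t + b ^ 2 * t⁻¹ := by
    have h2 : a ^ 2 * t + b ^ 2 * t⁻¹ - 2 * (a * b) = (a * t - b) ^ 2 * t⁻¹ := by
      field_simp; ring
    have : 0 ≤ (a * t - b) ^ 2 * t⁻¹ := by positivity
    linarith
  have h3 : a + b ≤ 2 * (a * b) := by nlinarith
  have h4 : t + t⁻¹ ≤ a ^ 2 * t + b ^ 2 * t⁻¹ := by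
    have : 1 ≤ a ^ 2 := by nlinarith
    have : 1 ≤ b ^ 2 := by nlinarith
    nlinarith
  have := Real.pi_pos
  nlinarith

/-- The general term of the product of theta-type series at `t` and `1 / t`. -/
noncomputable def pairTerm (p : ℕ+ × ℕ+) (t : ℝ) : ℝ :=
  (p.1 : ℝ) ^ 2 *
    (Real.exp (-Real.pi * (p.1 : ℝ) ^ 2 * t) * Real.exp (-Real.pi * (p.2 : ℝ) ^ 2 * t⁻¹))

theorem thetaSum_one_mul {t : ℝ} (ht : 0 < t) :
    thetaSum 1 t * thetaSum 0 t⁻¹ = ∑' p : ℕ+ × ℕ+, pairTerm p t := by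
  rw [thetaSum, thetaSum, tsum_mul_tsum_of_summable_norm (summable_thetaSum 1 ht).norm
    (summable_thetaSum 0 (inv_pos.2 ht)).norm]
  simp [pairTerm, mul_assoc]

/-- A dominating function for products of theta-type series at `t` and `1 / t`. -/
noncomputable def expBound (t : ℝ) : ℝ := Real.exp (-(Real.pi / 2) * (t + t⁻¹))

theorem pairTerm_nonneg (p : ℕ+ × ℕ+) (t : ℝ) : 0 ≤ pairTerm p t := by
  unfold pairTerm; positivity

theorem pairTerm_le (p : ℕ+ × ℕ+) {t : ℝ} (ht : 0 < t) :
    pairTerm p t ≤ (p.1 : ℝ) ^ 2 *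
      (Real.exp (-(Real.pi / 2) * p.1) * Real.exp (-(Real.pi / 2) * p.2)) * expBound t := by
  rw [mul_assoc]
  exact mul_le_mul_of_nonneg_left
    (exp_add_le ht (Nat.one_le_cast.2 p.1.2) (Nat.one_le_cast.2 p.2.2)) (by positivity)

theorem summable_pairBound : Summable fun p : ℕ+ × ℕ+ => (p.1 : ℝ) ^ 2 *
    (Real.exp (-(Real.pi / 2) * p.1) * Real.exp (-(Real.pi / 2) * p.2)) := by
  have h := fun k => (Real.summable_pow_mul_exp_neg_nat_mul k (r := Real.pi / 2)
    (by positivity)).comp_injective PNat.coe_injective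
  refine ((h 2).mul_of_nonneg (h 0) (fun n => ?_) (fun n => ?_)).congr fun p => ?_
  · simp only [Pi.zero_apply, Function.comp_apply]; positivity
  · simp only [Pi.zero_apply, Function.comp_apply]; positivity
  · simp only [Function.comp_apply]; ring

theorem exists_thetaSum_mul_le : ∃ C, ∀ t : ℝ, 0 < t →
    thetaSum 1 t * thetaSum 0 t⁻¹ ≤ C * expBound t := by
  refine ⟨∑' p : ℕ+ × ℕ+, (p.1 : ℝ) ^ 2 *
    (Real.exp (-(Real.pi / 2) * p.1) * Real.exp (-(Real.pi / 2) * p.2)), fun t ht => ?_⟩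
  rw [thetaSum_one_mul ht, ← tsum_mul_right]
  have hs := summable_pairBound.mul_right (expBound t)
  exact (Summable.of_nonneg_of_le (fun p => pairTerm_nonneg p t)
    (fun p => pairTerm_le p ht) hs).tsum_le_tsum (fun p => pairTerm_le p ht) hs

theorem expBound_pos (t : ℝ) : 0 < expBound t := Real.exp_pos _

theorem expBound_isBigO_atTop (r : ℝ) : expBound =O[atTop] (· ^ r) := by
  refine Asymptotics.IsBigO.trans ?_
    (isLittleO_exp_neg_mul_rpow_atTop (half_pos Real.pi_pos) r).isBigO
  refine Asymptotics.IsBigO.of_bound 1 ?_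
  filter_upwards [eventually_gt_atTop 0] with t ht
  rw [expBound, one_mul, Real.norm_of_nonneg (Real.exp_pos _).le,
    Real.norm_of_nonneg (Real.exp_pos _).le]
  apply Real.exp_le_exp.2
  have : 0 < t⁻¹ := inv_pos.2 ht
  nlinarith [Real.pi_pos]

theorem expBound_inv (t : ℝ) : expBound t⁻¹ = expBound t := by
  rw [expBound, expBound, inv_inv, add_comm]

/-- The invariance of `expBound` under `t ↦ 1/t` transfers its decay at infinity to zero. -/
theorem expBound_isBigO_zero (r : ℝ) : expBound =O[𝓝[>] 0] (· ^ r) := by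
  have h := (expBound_isBigO_atTop (-r)).comp_tendsto tendsto_inv_nhdsGT_zero
  refine h.congr' (Eventually.of_forall fun t => expBound_inv t) ?_
  filter_upwards [self_mem_nhdsWithin] with t ht
  simp only [Function.comp_apply]
  rw [Real.rpow_neg (inv_pos.2 ht).le, Real.inv_rpow (le_of_lt ht), inv_inv]

/-- Functions on `(0, ∞)` that are continuous and dominated by `expBound`. -/
structure IsExpBounded (f : ℝ → ℂ) : Prop where
  continuousOn : ContinuousOn f (Ioi 0)
  bound : ∃ C, ∀ t : ℝ, 0 < t → ‖f t‖ ≤ C * expBound t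

theorem IsExpBounded.isBigO_atTop {f : ℝ → ℂ} (hf : IsExpBounded f) (r : ℝ) :
    f =O[atTop] (· ^ r) := by
  obtain ⟨C, hC⟩ := hf.bound
  refine Asymptotics.IsBigO.trans (Asymptotics.IsBigO.of_bound C ?_) (expBound_isBigO_atTop r)
  filter_upwards [eventually_gt_atTop 0] with t ht
  rw [Real.norm_of_nonneg (expBound_pos t).le]
  exact hC t ht

theorem IsExpBounded.isBigO_zero {f : ℝ → ℂ} (hf : IsExpBounded f) (r : ℝ) :
    f =O[𝓝[>] 0] (· ^ r) := by
  obtain ⟨C, hC⟩ := hf.bound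
  refine Asymptotics.IsBigO.trans (Asymptotics.IsBigO.of_bound C ?_) (expBound_isBigO_zero r)
  filter_upwards [self_mem_nhdsWithin] with t ht
  rw [Real.norm_of_nonneg (expBound_pos t).le]
  exact hC t ht

theorem IsExpBounded.mellinConvergent {f : ℝ → ℂ} (hf : IsExpBounded f) (s : ℂ) :
    MellinConvergent f s :=
  mellinConvergent_of_isBigO_rpow (hf.continuousOn.locallyIntegrableOn measurableSet_Ioi)
    (by simpa using hf.isBigO_atTop (-(s.re + 1))) (lt_add_one _)
    (by simpa using hf.isBigO_zero (-(s.re - 1))) (sub_one_lt _)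

theorem IsExpBounded.differentiable_mellin {f : ℝ → ℂ} (hf : IsExpBounded f) :
    Differentiable ℂ (mellin f) := fun s =>
  mellin_differentiableAt_of_isBigO_rpow (hf.continuousOn.locallyIntegrableOn measurableSet_Ioi)
    (by simpa using hf.isBigO_atTop (-(s.re + 1))) (lt_add_one _)
    (by simpa using hf.isBigO_zero (-(s.re - 1))) (sub_one_lt _)

theorem isExpBounded_thetaSum_one :
    IsExpBounded fun t => (thetaSum 1 t : ℂ) * thetaSum 0 t⁻¹ := by
  refine ⟨?_, ?_⟩
  · have h1 := continuousOn_thetaSum 1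
    have h2 := (continuousOn_thetaSum 0).comp (f := fun t : ℝ => t⁻¹) (s := Ioi 0)
      (continuousOn_inv₀.mono fun t ht => ne_of_gt ht) fun t ht => inv_pos.2 (show 0 < t from ht)
    exact (continuous_ofReal.comp_continuousOn h1).mul (continuous_ofReal.comp_continuousOn h2)
  · obtain ⟨C, hC⟩ := exists_thetaSum_mul_le
    refine ⟨C, fun t ht => ?_⟩
    rw [← ofReal_mul, norm_real, Real.norm_of_nonneg
      (mul_nonneg (thetaSum_nonneg _ _) (thetaSum_nonneg _ _))]
    exact hC t ht

theorem isExpBounded_thetaSum_zero :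
    IsExpBounded fun t => (thetaSum 0 t : ℂ) * thetaSum 0 t⁻¹ := by
  refine ⟨?_, ?_⟩
  · have h1 := continuousOn_thetaSum 0
    have h2 := (continuousOn_thetaSum 0).comp (f := fun t : ℝ => t⁻¹) (s := Ioi 0)
      (continuousOn_inv₀.mono fun t ht => ne_of_gt ht) fun t ht => inv_pos.2 (show 0 < t from ht)
    exact (continuous_ofReal.comp_continuousOn h1).mul (continuous_ofReal.comp_continuousOn h2)
  · obtain ⟨C, hC⟩ := exists_thetaSum_mul_le
    refine ⟨C, fun t ht => ?_⟩
    rw [← ofReal_mul, norm_real, Real.norm_of_nonneg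
      (mul_nonneg (thetaSum_nonneg _ _) (thetaSum_nonneg _ _))]
    exact (mul_le_mul_of_nonneg_right (thetaSum_zero_le t ht) (thetaSum_nonneg _ _)).trans (hC t ht)

/-! ### The MacDonald sum as a Mellin transform. -/

theorem isExpBounded_of_pi_div_two_le {y : ℝ} (hy : Real.pi / 2 ≤ y) :
    IsExpBounded fun t => ((Real.exp (-y * (t + t⁻¹)) : ℝ) : ℂ) := by
  refine ⟨?_, 1, fun t ht => ?_⟩
  · refine continuous_ofReal.comp_continuousOn (Real.continuous_exp.comp_continuousOn ?_)
    exact continuousOn_const.mul (continuousOn_id.add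
      (continuousOn_inv₀.mono fun t ht => ne_of_gt ht))
  · rw [norm_real, Real.norm_of_nonneg (Real.exp_pos _).le, one_mul, expBound]
    apply Real.exp_le_exp.2
    have : 0 < t⁻¹ := inv_pos.2 ht
    nlinarith

/-- Under `t = e^u`, `t + 1/t` becomes `2 cosh u`; folding the integral over the line at zero pairs
`e^(νu)` with `e^(-νu)`. -/
theorem mellin_eq_two_mul_macdonaldK {y : ℝ} (hy : Real.pi / 2 ≤ y) (ν : ℂ) :
    mellin (fun t => ((Real.exp (-y * (t + t⁻¹)) : ℝ) : ℂ)) ν = 2 * macdonaldK ν (2 * y) := by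
  have hconv := (isExpBounded_of_pi_div_two_le hy).mellinConvergent ν
  set f : ℝ → ℂ := fun t => (t : ℂ) ^ (ν - 1) • ((Real.exp (-y * (t + t⁻¹)) : ℝ) : ℂ) with hf
  set g : ℝ → ℂ := fun u => ((Real.exp (-(2 * y) * Real.cosh u) : ℝ) : ℂ) * cexp (ν * u) with hg
  have himg : Real.exp '' univ = Ioi 0 := by rw [image_univ, Real.range_exp]
  have hder : ∀ x ∈ (univ : Set ℝ), HasDerivWithinAt Real.exp (Real.exp x) univ x :=
    fun x _ => (Real.hasDerivAt_exp x).hasDerivWithinAt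
  have hfg : ∀ u : ℝ, |Real.exp u| • f (Real.exp u) = g u := fun u => by
    have h1 : ((Real.exp u : ℝ) : ℂ) ^ (ν - 1) = cexp (ν * u) / cexp u := by
      rw [cpow_def_of_ne_zero (ofReal_ne_zero.2 (Real.exp_pos u).ne'), ← ofReal_log
        (Real.exp_pos u).le, Real.log_exp, ← Complex.exp_sub]
      ring_nf
    have h2 : -y * (Real.exp u + (Real.exp u)⁻¹) = -(2 * y) * Real.cosh u := by
      rw [Real.cosh_eq, Real.exp_neg]; ring
    have h3 : cexp (u : ℂ) ≠ 0 := Complex.exp_ne_zero _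
    simp only [hf, hg]
    rw [abs_of_pos (Real.exp_pos u), h1, h2, real_smul, smul_eq_mul, ofReal_exp u]
    field_simp
  have e1 : ∫ t in Ioi 0, f t = ∫ u, g u := by
    rw [← himg, integral_image_eq_integral_abs_deriv_smul MeasurableSet.univ hder
      Real.exp_injective.injOn, setIntegral_univ]
    simp_rw [hfg]
  have hint : Integrable g := by
    have := (integrableOn_image_iff_integrableOn_abs_deriv_smul MeasurableSet.univ hder
      Real.exp_injective.injOn f).1 (by rw [himg]; exact hconv)
    rw [integrableOn_univ] at this
    exact this.congr (Eventually.of_forall hfg)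
  have e2 : ∫ u, g u = ∫ u in Ioi 0, (g (-u) + g u) := by
    rw [← intervalIntegral.integral_Iic_add_Ioi (b := 0) hint.integrableOn hint.integrableOn,
      integral_add hint.comp_neg.integrableOn hint.integrableOn, integral_comp_neg_Ioi, neg_zero]
  rw [mellin, e1, e2, macdonaldK, ← integral_const_mul]
  refine setIntegral_congr_fun measurableSet_Ioi fun u _ => ?_
  simp only [hg, Real.cosh_neg, Complex.cosh]
  push_cast
  ring_nf

theorem mellin_pairTerm (p : ℕ+ × ℕ+) (ν : ℂ) :
    mellin (fun t => (pairTerm p t : ℂ)) ν = 2 * (((p.2 : ℕ) : ℂ) ^ ν / ((p.1 : ℕ) : ℂ) ^ (ν - 2) *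
      macdonaldK ν (2 * Real.pi * (p.1 : ℕ) * (p.2 : ℕ))) := by
  obtain ⟨a, b⟩ := p
  have ha : (1 : ℝ) ≤ a := Nat.one_le_cast.2 a.2
  have hb : (1 : ℝ) ≤ b := Nat.one_le_cast.2 b.2
  have ha0 : (0 : ℝ) < a := by linarith
  have hb0 : (0 : ℝ) < b := by linarith
  have hac : ((a : ℕ) : ℂ) ≠ 0 := by exact_mod_cast ha0.ne'
  have hbc : ((b : ℕ) : ℂ) ≠ 0 := by exact_mod_cast hb0.ne'
  have hy : Real.pi / 2 ≤ Real.pi * a * b := by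
    have : 1 ≤ (a : ℝ) * b := by nlinarith
    nlinarith [Real.pi_pos]
  have hba : (0 : ℝ) < b / a := by positivity
  -- Scaling `t` by `b/a` makes the coefficients of `t` and `1/t` both equal to `πab`.
  have e1 := mellin_comp_mul_left (fun t => (pairTerm (a, b) t : ℂ)) ν hba
  have e2 : mellin (fun t => (pairTerm (a, b) (b / a * t) : ℂ)) ν =
      ((a : ℕ) : ℂ) ^ 2 * (2 * macdonaldK ν (2 * (Real.pi * a * b))) := by
    rw [← mellin_eq_two_mul_macdonaldK hy, ← smul_eq_mul, ← mellin_const_smul]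
    refine setIntegral_congr_fun measurableSet_Ioi fun t ht => ?_
    have ht0 : (t : ℝ) ≠ 0 := ne_of_gt ht
    simp only [pairTerm, smul_eq_mul]
    rw [← Real.exp_add]
    have : -Real.pi * (a : ℝ) ^ 2 * (b / a * t) + -Real.pi * (b : ℝ) ^ 2 * (b / a * t)⁻¹ =
        -(Real.pi * a * b) * (t + t⁻¹) := by
      field_simp
      ring
    rw [this]
    push_cast
    rfl
  rw [e2] at e1
  have e3 : ((b / a : ℝ) : ℂ) ^ (-ν) = ((a : ℕ) : ℂ) ^ ν / ((b : ℕ) : ℂ) ^ ν := by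
    rw [ofReal_div, div_cpow_ofReal_nonneg hb0.le ha0.le, cpow_neg, cpow_neg, ofReal_natCast,
      ofReal_natCast, inv_div_inv]
  have hbn : ((b : ℕ) : ℂ) ^ ν ≠ 0 := by simp [cpow_eq_zero_iff, hbc]
  have han : ((a : ℕ) : ℂ) ^ ν ≠ 0 := by simp [cpow_eq_zero_iff, hac]
  rw [e3, smul_eq_mul, show 2 * (Real.pi * a * b) = 2 * Real.pi * (a : ℕ) * (b : ℕ) by ring] at e1
  have e4 : ((a : ℕ) : ℂ) ^ (ν - 2) = ((a : ℕ) : ℂ) ^ ν / ((a : ℕ) : ℂ) ^ 2 := by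
    rw [cpow_sub _ _ hac]; norm_cast
  rw [e4]
  field_simp at e1 ⊢
  linear_combination -e1

theorem isExpBounded_pairTerm (p : ℕ+ × ℕ+) : IsExpBounded fun t => (pairTerm p t : ℂ) := by
  refine ⟨?_, (p.1 : ℝ) ^ 2 * (Real.exp (-(Real.pi / 2) * p.1) * Real.exp (-(Real.pi / 2) * p.2)),
    fun t ht => ?_⟩
  rotate_left
  · rw [norm_real, Real.norm_of_nonneg (pairTerm_nonneg p t)]
    exact pairTerm_le p ht
  · have h : ContinuousOn (fun t : ℝ => t⁻¹) (Ioi 0) :=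
      continuousOn_inv₀.mono fun t ht => ne_of_gt ht
    refine continuous_ofReal.comp_continuousOn ?_
    unfold pairTerm
    fun_prop

theorem isExpBounded_expBound : IsExpBounded fun t => (expBound t : ℂ) :=
  isExpBounded_of_pi_div_two_le le_rfl

theorem hasSum_mellin_pairTerm (ν : ℂ) :
    HasSum (fun p => mellin (fun t => (pairTerm p t : ℂ)) ν)
      (mellin (fun t => (thetaSum 1 t : ℂ) * thetaSum 0 t⁻¹) ν) := by
  have key := hasSum_integral_of_summable_integral_norm
    (F := fun (p : ℕ+ × ℕ+) (t : ℝ) => (t : ℂ) ^ (ν - 1) • (pairTerm p t : ℂ))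
    (μ := volume.restrict (Ioi 0)) (fun p => (isExpBounded_pairTerm p).mellinConvergent ν) ?_
  · convert! key using 1
    refine setIntegral_congr_fun measurableSet_Ioi fun t ht => ?_
    simp only
    rw [tsum_const_smul'', ← ofReal_tsum, ← ofReal_mul, thetaSum_one_mul ht]
  · refine Summable.of_nonneg_of_le (fun p => by positivity) (fun p => ?_)
      (summable_pairBound.mul_right
        (∫ t in Ioi (0 : ℝ), ‖(t : ℂ) ^ (ν - 1) • (expBound t : ℂ)‖))
    rw [← integral_const_mul]
    refine setIntegral_mono_on ((isExpBounded_pairTerm p).mellinConvergent ν).norm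
      ((isExpBounded_expBound.mellinConvergent ν).norm.const_mul _) measurableSet_Ioi
      fun t ht => ?_
    rw [norm_smul, norm_smul, norm_real, norm_real, Real.norm_of_nonneg (pairTerm_nonneg p t),
      Real.norm_of_nonneg (expBound_pos t).le, mul_left_comm]
    exact mul_le_mul_of_nonneg_left (pairTerm_le p ht) (norm_nonneg _)

theorem K_one_one (s : ℂ) : K 1 1 s 1 =
    Real.pi / 2 * mellin (fun t => (thetaSum 1 t : ℂ) * thetaSum 0 t⁻¹) (s + 1 / 2) := by
  rw [K, ← (hasSum_mellin_pairTerm (s + 1 / 2)).tsum_eq]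
  simp_rw [mellin_pairTerm]
  rw [tsum_mul_left]
  have : ∀ x : ℂ, (Real.pi : ℂ) ^ 1 * x = Real.pi / 2 * (2 * x) := fun x => by ring
  rw [this]
  congr 3
  funext p
  push_cast
  rw [mul_one]
  ring_nf

/-! ### `K` and the lattice sum in terms of `ξ₁`, for `Re s > 1`. -/

theorem hasMellin_congr {f g : ℝ → ℂ} {s m : ℂ} (hf : HasMellin f s m) (h : EqOn f g (Ioi 0)) :
    HasMellin g s m := by
  have h' : EqOn (fun t : ℝ => (t : ℂ) ^ (s - 1) • f t) (fun t : ℝ => (t : ℂ) ^ (s - 1) • g t)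
      (Ioi 0) := fun t ht => by simp only [h ht]
  exact ⟨hf.1.congr_fun h' measurableSet_Ioi,
    (setIntegral_congr_fun measurableSet_Ioi h'.symm).trans hf.2⟩

/-- The theta-type series `∑ n ≥ 1, exp(-π n² t)`, with complex values. -/
noncomputable def psi (t : ℝ) : ℂ := thetaSum 0 t

/-- The square of the Jacobi theta function minus its limit at infinity, in terms of `psi`. -/
noncomputable def thetaSqSubOne (t : ℝ) : ℂ := 4 * (psi t + psi t ^ 2)

theorem thetaSqPair_f_sub {t : ℝ} (ht : 0 < t) :
    thetaSqPair.f t - thetaSqPair.f₀ = thetaSqSubOne t := by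
  change ((HurwitzZeta.evenKernel 0 t : ℝ) : ℂ) ^ 2 - 1 = _
  rw [evenKernel_zero_eq ht, thetaSqSubOne, psi]
  push_cast
  ring

theorem hurwitzEvenFEPair_f_sub {t : ℝ} (ht : 0 < t) :
    (HurwitzZeta.hurwitzEvenFEPair 0).f t - (HurwitzZeta.hurwitzEvenFEPair 0).f₀ = 2 * psi t := by
  change ((HurwitzZeta.evenKernel 0 t : ℝ) : ℂ) - (if (0 : UnitAddCircle) = 0 then 1 else 0) = _
  rw [evenKernel_zero_eq ht, psi, if_pos rfl]
  push_cast
  ring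

theorem hasMellin_psi {s : ℂ} (hs : 1 / 2 < s.re) : HasMellin psi s (ξ₁ (2 * s)) := by
  have h := (HurwitzZeta.hurwitzEvenFEPair 0).hasMellin (s := s) hs
  have h2 := hasMellin_congr h fun t ht => hurwitzEvenFEPair_f_sub ht
  have h3 := hasMellin_const_smul h2.1 (2⁻¹ : ℂ)
  rw [h2.2] at h3
  have e : ξ₁ (2 * s) = (2⁻¹ : ℂ) • (HurwitzZeta.hurwitzEvenFEPair 0).Λ s := by
    rw [ξ₁, completedRiemannZeta, HurwitzZeta.completedHurwitzZetaEven, mul_div_cancel_left₀ _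
      two_ne_zero, smul_eq_mul]
    ring
  rw [e]
  exact hasMellin_congr h3 fun t _ => by simp

theorem hasMellin_thetaSqSubOne {s : ℂ} (hs : 1 < s.re) :
    HasMellin thetaSqSubOne s (thetaSqPair.Λ s) :=
  hasMellin_congr (thetaSqPair.hasMellin hs) fun _ ht => thetaSqPair_f_sub ht

theorem psi_isBigO_atTop (r : ℝ) : psi =O[atTop] (· ^ r) := by
  have h := ((HurwitzZeta.hurwitzEvenFEPair 0).hf_top r).const_mul_left (2⁻¹ : ℂ)
  refine h.congr' ?_ EventuallyEq.rfl
  filter_upwards [eventually_gt_atTop 0] with t ht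
  rw [hurwitzEvenFEPair_f_sub ht]; ring

theorem thetaSqSubOne_isBigO_atTop (r : ℝ) : thetaSqSubOne =O[atTop] (· ^ r) := by
  refine (thetaSqPair.hf_top r).congr' ?_ EventuallyEq.rfl
  filter_upwards [eventually_gt_atTop 0] with t ht
  exact thetaSqPair_f_sub ht

theorem psi_isBigO_zero : psi =O[𝓝[>] 0] (· ^ (-(1 / 2) : ℝ)) := by
  have h := ((HurwitzZeta.hurwitzEvenFEPair 0).hf_zero').const_mul_left (2⁻¹ : ℂ)
  refine h.congr' ?_ EventuallyEq.rfl
  filter_upwards [self_mem_nhdsWithin] with t ht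
  rw [hurwitzEvenFEPair_f_sub ht]; ring

theorem thetaSqSubOne_isBigO_zero : thetaSqSubOne =O[𝓝[>] 0] (· ^ (-1 : ℝ)) := by
  refine thetaSqPair.hf_zero'.congr' ?_ EventuallyEq.rfl
  filter_upwards [self_mem_nhdsWithin] with t ht
  exact thetaSqPair_f_sub ht

theorem norm_cpow_isBigO {l : Filter ℝ} (hl : ∀ᶠ t in l, 0 < t) (s : ℂ) :
    (fun t : ℝ => (t : ℂ) ^ s) =O[l] (· ^ s.re) := by
  refine Asymptotics.IsBigO.of_bound 1 ?_
  filter_upwards [hl] with t ht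
  rw [norm_cpow_eq_rpow_re_of_pos ht, one_mul]
  exact le_abs_self _

theorem tendsto_cpow_mul_atTop {f : ℝ → ℂ} (hf : ∀ r : ℝ, f =O[atTop] (· ^ r)) (s : ℂ) :
    Tendsto (fun t : ℝ => (t : ℂ) ^ s * f t) atTop (𝓝 0) := by
  have h := (norm_cpow_isBigO (eventually_gt_atTop 0) s).mul (hf (-s.re - 1))
  refine h.trans_tendsto ?_
  refine (tendsto_rpow_neg_atTop one_pos).congr' ?_
  filter_upwards [eventually_gt_atTop 0] with t ht
  rw [← Real.rpow_add ht]
  congr 1; ring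

theorem tendsto_cpow_mul_zero {f : ℝ → ℂ} {b : ℝ} (hf : f =O[𝓝[>] 0] (· ^ (-b))) {s : ℂ}
    (hs : b < s.re) : Tendsto (fun t : ℝ => (t : ℂ) ^ s * f t) (𝓝[>] 0) (𝓝 0) := by
  have h := (norm_cpow_isBigO (l := 𝓝[>] 0) self_mem_nhdsWithin s).mul hf
  refine h.trans_tendsto ?_
  have h2 : Tendsto (fun t : ℝ => t ^ (s.re - b)) (𝓝[>] 0) (𝓝 0) := by
    have := (Real.continuousAt_rpow_const 0 (s.re - b) (Or.inr (by linarith))).tendsto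
    rw [Real.zero_rpow (by linarith)] at this
    exact this.mono_left nhdsWithin_le_nhds
  refine h2.congr' ?_
  filter_upwards [self_mem_nhdsWithin] with t ht
  rw [← Real.rpow_add ht]
  congr 1

theorem hasDerivAt_psi {t : ℝ} (ht : 0 < t) : HasDerivAt psi (-Real.pi * thetaSum 1 t) t := by
  exact (hasDerivAt_thetaSum 0 ht).ofReal_comp.congr_deriv (by push_cast; rfl)

theorem hasDerivAt_thetaSqSubOne {t : ℝ} (ht : 0 < t) :
    HasDerivAt thetaSqSubOne (4 * (-Real.pi * thetaSum 1 t * (1 + 2 * psi t))) t := by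
  have h := hasDerivAt_psi ht
  refine ((h.add (h.pow 2)).const_mul (4 : ℂ)).congr_deriv ?_
  push_cast
  ring

theorem hasDerivAt_cpow {t : ℝ} (ht : 0 < t) (s : ℂ) :
    HasDerivAt (fun t : ℝ => (t : ℂ) ^ s) (s * (t : ℂ) ^ (s - 1)) t := by
  have h : HasDerivAt (fun z : ℂ => z ^ s) (s * (t : ℂ) ^ (s - 1) * 1) (t : ℂ) :=
    (hasDerivAt_id' (t : ℂ)).cpow_const (Or.inl (by simpa using ht))
  rw [mul_one] at h
  exact h.comp_ofReal

theorem psi_inv {t : ℝ} (ht : 0 < t) : psi t⁻¹ = √t * psi t + (√t - 1) / 2 := by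
  rw [psi, psi, thetaSum_zero_inv ht]
  push_cast
  ring

theorem ofReal_cpow_half_shift {t : ℝ} (ht : 0 < t) (s : ℂ) :
    (t : ℂ) ^ (s + 1 / 2) = √t * (t : ℂ) ^ s := by
  rw [cpow_add _ _ (ofReal_ne_zero.2 ht.ne'), Real.sqrt_eq_rpow, ofReal_cpow ht.le, mul_comm]
  push_cast
  rfl

/-- The Mellin transform of `ψ(t) ψ(1/t)`, shifted to be symmetric under `s ↦ 1 - s`. -/
noncomputable def mellinPsi (s : ℂ) : ℂ :=
  mellin (fun t => (thetaSum 0 t : ℂ) * thetaSum 0 t⁻¹) (s - 1 / 2)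

theorem differentiable_mellinPsi : Differentiable ℂ mellinPsi :=
  isExpBounded_thetaSum_zero.differentiable_mellin.comp (by fun_prop)

theorem mellinPsi_one_sub (s : ℂ) : mellinPsi (1 - s) = mellinPsi s := by
  rw [mellinPsi, mellinPsi, show (1 : ℂ) - s - 1 / 2 = -(s - 1 / 2) by ring, ← mellin_comp_inv]
  simp only [inv_inv, mul_comm]

/-- A Selberg–Chowla formula: by the theta functional equation `4 ψ(t) ψ(1/t) = √t (θ² - 1) - 2 √t ψ
- 2 ψ`, transformed at `s - 1/2`. -/
theorem Λ_thetaSqPair_eq {s : ℂ} (hs : 1 < s.re) :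
    thetaSqPair.Λ s = 2 * (ξ₁ (2 * s) + ξ₁ (2 * s - 1) + 2 * mellinPsi s) := by
  have hD := hasMellin_thetaSqSubOne hs
  have hA := hasMellin_psi (s := s) (by linarith)
  have hB := hasMellin_psi (s := s - 1 / 2) (by simp; linarith)
  rw [show 2 * (s - 1 / 2) = 2 * s - 1 by ring] at hB
  have key : 4 * mellinPsi s = thetaSqPair.Λ s - 2 * ξ₁ (2 * s) - 2 * ξ₁ (2 * s - 1) := by
    rw [← hD.2, ← hA.2, ← hB.2, mellinPsi]
    unfold mellin
    rw [← integral_const_mul, ← integral_const_mul, ← integral_const_mul,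
      ← integral_sub' hD.1 (hA.1.const_mul 2),
      ← integral_sub (hD.1.sub (hA.1.const_mul 2)) (hB.1.const_mul 2)]
    refine setIntegral_congr_fun measurableSet_Ioi fun t ht => ?_
    have e1 : (t : ℂ) ^ (s - 1) = √t * (t : ℂ) ^ (s - 1 / 2 - 1) := by
      rw [← ofReal_cpow_half_shift ht]; ring_nf
    simp only [Pi.sub_apply, smul_eq_mul]
    change 4 * (_ * (psi t * psi t⁻¹)) = _
    rw [psi_inv ht, e1, thetaSqSubOne]
    ring
  linear_combination -key

/-- Integration by parts. With `ψ' = -π thetaSum 1` and `ψ(1/t) = √t (ψ + 1/2) - 1/2`, the product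
`ψ' ψ(1/t)` is `√t (θ² - 1)' / 8 - ψ' / 2`. -/
theorem eight_mul_mellin_eq {s : ℂ} (hs : 1 < s.re) :
    8 * (Real.pi * mellin (fun t => (thetaSum 1 t : ℂ) * thetaSum 0 t⁻¹) (s + 1 / 2)) =
      s * thetaSqPair.Λ s - 4 * (s - 1 / 2) * ξ₁ (2 * s - 1) := by
  have hD := hasMellin_thetaSqSubOne hs
  have hre : (s - 1 / 2).re = s.re - 1 / 2 := by simp
  have hB := hasMellin_psi (s := s - 1 / 2) (by rw [hre]; linarith)
  rw [show 2 * (s - 1 / 2) = 2 * s - 1 by ring] at hB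
  have hJ := isExpBounded_thetaSum_one.mellinConvergent (s + 1 / 2)
  -- The boundary term of the integration by parts; `Re s > 1` makes it vanish at zero, where `θ² -
  -- 1` grows like `1/t`.
  set Q : ℝ → ℂ := fun t => (t : ℂ) ^ s * thetaSqSubOne t * (1 / 8) -
    (t : ℂ) ^ (s - 1 / 2) * psi t * (1 / 2) with hQ
  set Q' : ℝ → ℂ := fun t => s / 8 * ((t : ℂ) ^ (s - 1) • thetaSqSubOne t) -
    Real.pi * ((t : ℂ) ^ (s + 1 / 2 - 1) • ((thetaSum 1 t : ℂ) * thetaSum 0 t⁻¹)) -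
    (s - 1 / 2) / 2 * ((t : ℂ) ^ (s - 1 / 2 - 1) • psi t) with hQ'
  have hint := (hD.1.const_mul (s / 8)).sub (hJ.const_mul (Real.pi : ℂ))
  have hs0 : s ≠ 0 := by rintro rfl; norm_num at hs
  have hs1 : s - 1 / 2 ≠ 0 := by
    intro h; rw [h] at hre; rw [zero_re] at hre; linarith
  -- The power `0 ^ s = 0` annihilates the meaningless values of the theta series at zero.
  have hQ0 : Q 0 = 0 := by
    simp only [hQ]
    rw [ofReal_zero, zero_cpow hs0, zero_cpow hs1]; ring
  have hder : ∀ t ∈ Ioi (0 : ℝ), HasDerivAt Q (Q' t) t := fun t ht => by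
    have ht' : 0 < t := ht
    have h1 := (((hasDerivAt_cpow ht' s).mul (hasDerivAt_thetaSqSubOne ht')).mul_const (1 / 8)).sub
      (((hasDerivAt_cpow ht' (s - 1 / 2)).mul (hasDerivAt_psi ht')).mul_const (1 / 2))
    refine h1.congr_deriv ?_
    have e1 : (t : ℂ) ^ (s - 1) = √t * (t : ℂ) ^ (s - 1 / 2 - 1) := by
      rw [← ofReal_cpow_half_shift ht']; ring_nf
    have e2 : (t : ℂ) ^ (s - 1 / 2) = √t * (√t * (t : ℂ) ^ (s - 1 / 2 - 1)) := by
      rw [← e1, ← ofReal_cpow_half_shift ht']; ring_nf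
    have e3 : (t : ℂ) ^ s = √t * (√t * (√t * (t : ℂ) ^ (s - 1 / 2 - 1))) := by
      rw [← e2, ← ofReal_cpow_half_shift ht']; ring_nf
    have e4 : (t : ℂ) ^ (s + 1 / 2 - 1) = (t : ℂ) ^ (s - 1 / 2) := by ring_nf
    simp only [hQ', smul_eq_mul]
    change _ = _ - Real.pi * (_ * (_ * psi t⁻¹)) - _
    rw [psi_inv ht', e4, e3, e2, e1]
    ring
  have hcont : ContinuousWithinAt Q (Ici 0) 0 := by
    rw [← continuousWithinAt_Ioi_iff_Ici, ContinuousWithinAt, hQ0]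
    have h1 := (tendsto_cpow_mul_zero thetaSqSubOne_isBigO_zero hs).mul_const (1 / 8 : ℂ)
    have h2 := (tendsto_cpow_mul_zero psi_isBigO_zero (s := s - 1 / 2)
      (by rw [hre]; linarith)).mul_const (1 / 2 : ℂ)
    have h3 := h1.sub h2
    rw [zero_mul, zero_mul, sub_zero] at h3
    exact h3
  have htop : Tendsto Q atTop (𝓝 0) := by
    have h1 := (tendsto_cpow_mul_atTop thetaSqSubOne_isBigO_atTop s).mul_const (1 / 8 : ℂ)
    have h2 := (tendsto_cpow_mul_atTop psi_isBigO_atTop (s - 1 / 2)).mul_const (1 / 2 : ℂ)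
    have h3 := h1.sub h2
    rw [zero_mul, zero_mul, sub_zero] at h3
    exact h3
  have key := integral_Ioi_of_hasDerivAt_of_tendsto hcont hder
    (hint.sub (hB.1.const_mul ((s - 1 / 2) / 2))) htop
  rw [hQ0, sub_zero] at key
  have e : ∫ t in Ioi 0, Q' t = s / 8 * thetaSqPair.Λ s -
      Real.pi * mellin (fun t => (thetaSum 1 t : ℂ) * thetaSum 0 t⁻¹) (s + 1 / 2) -
      (s - 1 / 2) / 2 * ξ₁ (2 * s - 1) := by
    rw [← hD.2, ← hB.2]
    unfold mellin
    rw [← integral_const_mul, ← integral_const_mul, ← integral_const_mul,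
      ← integral_sub' (hD.1.const_mul (s / 8)) (hJ.const_mul (Real.pi : ℂ)),
      ← integral_sub hint (hB.1.const_mul ((s - 1 / 2) / 2))]
    rfl
  rw [e] at key
  linear_combination -8 * key

theorem eight_mul_K_of_one_lt_re {s : ℂ} (hs : 1 < s.re) :
    8 * K 1 1 s 1 = L s + 2 * s * mellinPsi s := by
  have h1 := eight_mul_mellin_eq hs
  rw [Λ_thetaSqPair_eq hs] at h1
  rw [K_one_one, L]
  linear_combination h1 / 2

/-! ### Analytic continuation of the identities. -/

theorem S₀_eq_of_one_lt_re {s : ℂ} (hs : 1 < s.re) :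
    S₀ s = (Real.pi : ℂ) ^ s * (Gamma s)⁻¹ * thetaSqPair.Λ s := by
  have hs0 : 0 < s.re := by linarith
  have hG : Gamma s ≠ 0 := Gamma_ne_zero_of_re_pos hs0
  have hpi : (Real.pi : ℂ) ^ s ≠ 0 := by simp [cpow_eq_zero_iff, Real.pi_ne_zero]
  have hq : ∀ p : {p : ℤ × ℤ // p ≠ 0}, 0 < (p.1.1 : ℝ) ^ 2 + (p.1.2 : ℝ) ^ 2 := by
    rintro ⟨⟨a, b⟩, hp⟩
    have : a ≠ 0 ∨ b ≠ 0 := by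
      by_contra! h
      exact hp (by simp [h.1, h.2])
    rcases this with h | h
    · have : (a : ℝ) ≠ 0 := by exact_mod_cast h
      simp only; positivity
    · have : (b : ℝ) ≠ 0 := by exact_mod_cast h
      simp only; positivity
  have key := hasSum_mellin_pi_mul
    (a := fun _ : {p : ℤ × ℤ // p ≠ 0} => (1 : ℂ))
    (q := fun p : {p : ℤ × ℤ // p ≠ 0} => (p.1.1 : ℝ) ^ 2 + (p.1.2 : ℝ) ^ 2)
    (F := fun t => thetaSqPair.f t - thetaSqPair.f₀) (s := s)
    (fun p => Or.inr (hq p)) hs0 (fun t ht => hasSum_thetaSq ht) (summable_lattice hs)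
  rw [(thetaSqPair.hasMellin (s := s) hs).2] at key
  refine (S₀_spec.2 s hs).unique ?_
  refine (key.mul_left ((Real.pi : ℂ) ^ s * (Gamma s)⁻¹)).congr_fun fun p => ?_
  rw [cpow_neg]
  push_cast
  field_simp

/-- Half of `π^(-s) Γ(s) S₀(s)`, written through the MacDonald sums. -/
noncomputable def completedLattice (s : ℂ) : ℂ := ξ₁ (2 * s) + ξ₁ (2 * s - 1) + 2 * mellinPsi s

theorem completedLattice_one_sub (s : ℂ) : completedLattice (1 - s) = completedLattice s := by
  rw [completedLattice, completedLattice, ξ₁_two_mul_one_sub, ξ₁_two_mul_one_sub_sub_one,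
    mellinPsi_one_sub]
  ring

theorem differentiableAt_ξ₁_two_mul {s : ℂ} (h0 : s ≠ 0) (h1 : s ≠ 1 / 2) :
    DifferentiableAt ℂ (fun s => ξ₁ (2 * s)) s := by
  have h := differentiableAt_completedZeta (s := 2 * s) (mul_ne_zero two_ne_zero h0)
    (fun h => h1 (by linear_combination h / 2))
  exact h.comp s (f := fun s => 2 * s) (by fun_prop)

theorem differentiableAt_ξ₁_two_mul_sub_one {s : ℂ} (h1 : s ≠ 1 / 2) (h2 : s ≠ 1) :
    DifferentiableAt ℂ (fun s => ξ₁ (2 * s - 1)) s := by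
  have h := differentiableAt_completedZeta (s := 2 * s - 1)
    (fun h => h1 (by linear_combination h / 2)) (fun h => h2 (by linear_combination h / 2))
  exact h.comp s (f := fun s => 2 * s - 1) (by fun_prop)

/-- The identity theorem: the plane minus three points is connected. -/
theorem eqOn_of_eq_of_one_lt_re {f g : ℂ → ℂ} (hf : DifferentiableOn ℂ f {0, 1 / 2, 1}ᶜ)
    (hg : DifferentiableOn ℂ g {0, 1 / 2, 1}ᶜ) (hfg : ∀ s : ℂ, 1 < s.re → f s = g s) :
    EqOn f g {0, 1 / 2, 1}ᶜ := by
  have hfin : ({0, 1 / 2, 1} : Set ℂ).Finite := by simp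
  have hopen : IsOpen ({0, 1 / 2, 1}ᶜ : Set ℂ) := hfin.isClosed.isOpen_compl
  have hconn : IsPreconnected ({0, 1 / 2, 1}ᶜ : Set ℂ) :=
    (hfin.countable.isConnected_compl_of_one_lt_rank (by simp)).isPreconnected
  have h2 : (2 : ℂ) ∈ ({0, 1 / 2, 1}ᶜ : Set ℂ) := by
    simp only [mem_compl_iff, mem_insert_iff, mem_singleton_iff]
    norm_num
  refine (hf.analyticOnNhd hopen).eqOn_of_preconnected_of_eventuallyEq (hg.analyticOnNhd hopen)
    hconn h2 ?_
  filter_upwards [(isOpen_lt continuous_const continuous_re).mem_nhds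
    (show (1 : ℝ) < (2 : ℂ).re by norm_num)] with s hs
  exact hfg s hs

theorem S₀_eq {s : ℂ} (h0 : s ≠ 0) (h1 : s ≠ 1 / 2) (h2 : s ≠ 1) :
    S₀ s = (Real.pi : ℂ) ^ s * (Gamma s)⁻¹ * (2 * completedLattice s) := by
  have hpi : (Real.pi : ℂ) ≠ 0 := ofReal_ne_zero.2 Real.pi_ne_zero
  refine eqOn_of_eq_of_one_lt_re (f := S₀)
    (g := fun s => (Real.pi : ℂ) ^ s * (Gamma s)⁻¹ * (2 * completedLattice s))
    (S₀_spec.1.mono (by simp)) ?_ ?_ (by simpa [h0, h2] using h1)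
  · intro z hz
    simp only [mem_compl_iff, mem_insert_iff, mem_singleton_iff, not_or] at hz
    refine DifferentiableAt.differentiableWithinAt ?_
    have hA := differentiableAt_ξ₁_two_mul hz.1 hz.2.1
    have hB := differentiableAt_ξ₁_two_mul_sub_one hz.2.1 hz.2.2
    refine ((differentiableAt_id.const_cpow (Or.inl hpi)).mul
      (differentiable_one_div_Gamma z)).mul ?_
    exact ((hA.add hB).add ((differentiable_mellinPsi z).const_mul 2)).const_mul 2
  · intro z hz
    rw [S₀_eq_of_one_lt_re hz, Λ_thetaSqPair_eq hz]
    rfl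

theorem differentiable_K_one_one : Differentiable ℂ fun s => K 1 1 s 1 := by
  have h : (fun s => K 1 1 s 1) = fun s => Real.pi / 2 *
      mellin (fun t => (thetaSum 1 t : ℂ) * thetaSum 0 t⁻¹) (s + 1 / 2) := funext K_one_one
  rw [h]
  exact (isExpBounded_thetaSum_one.differentiable_mellin.comp
    (f := fun s : ℂ => s + 1 / 2) (by fun_prop)).const_mul _

theorem eight_mul_K {s : ℂ} (h0 : s ≠ 0) (h1 : s ≠ 1 / 2) (h2 : s ≠ 1) :
    8 * K 1 1 s 1 = s * completedLattice s + (1 - 2 * s) * ξ₁ (2 * s - 1) := by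
  refine eqOn_of_eq_of_one_lt_re (f := fun s => 8 * K 1 1 s 1)
    (g := fun s => s * completedLattice s + (1 - 2 * s) * ξ₁ (2 * s - 1))
    (differentiable_K_one_one.const_mul 8).differentiableOn ?_ ?_ (by simpa [h0, h2] using h1)
  · intro z hz
    simp only [mem_compl_iff, mem_insert_iff, mem_singleton_iff, not_or] at hz
    refine DifferentiableAt.differentiableWithinAt ?_
    have hA := differentiableAt_ξ₁_two_mul hz.1 hz.2.1
    have hB := differentiableAt_ξ₁_two_mul_sub_one hz.2.1 hz.2.2
    have hC : DifferentiableAt ℂ completedLattice z :=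
      (hA.add hB).add ((differentiable_mellinPsi z).const_mul 2)
    exact (differentiableAt_id.mul hC).add
      (DifferentiableAt.mul (by fun_prop) hB)
  · intro z hz
    rw [eight_mul_K_of_one_lt_re hz, L, completedLattice]
    ring

theorem eight_mul_K_one_sub {s : ℂ} (h0 : s ≠ 0) (h1 : s ≠ 1 / 2) (h2 : s ≠ 1) :
    8 * K 1 1 (1 - s) 1 = (1 - s) * completedLattice s + (2 * s - 1) * ξ₁ (2 * s) := by
  rw [eight_mul_K (s := 1 - s) (sub_ne_zero.2 h2.symm)
    (fun h => h1 (by linear_combination -h)) (by simpa using h0), completedLattice_one_sub,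
    ξ₁_two_mul_one_sub_sub_one]
  ring

/-! ### Trivial and nontrivial zeros of `S₀`. -/

/-- All terms are nonnegative reals and the one at `(1, 0)` equals `1`. -/
theorem S₀_natCast_ne_zero {n : ℕ} (hn : 2 ≤ n) : S₀ n ≠ 0 := by
  have h := S₀_spec.2 n (by simpa using (show 1 < n by omega))
  have e : ∀ p : {p : ℤ × ℤ // p ≠ 0}, 1 / ((p.1.1 : ℂ) ^ 2 + (p.1.2 : ℂ) ^ 2) ^ (n : ℂ) =
      ((1 / ((p.1.1 : ℝ) ^ 2 + (p.1.2 : ℝ) ^ 2) ^ n : ℝ) : ℂ) := fun p => by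
    rw [cpow_natCast]; push_cast; rfl
  simp_rw [e] at h
  have hre := hasSum_re h
  simp only [ofReal_re] at hre
  have hle := le_hasSum hre ⟨((1 : ℤ), (0 : ℤ)), by simp⟩ fun p _ => by positivity
  intro h0
  rw [h0] at hle
  norm_num at hle

/-- Reflection moves `-n` to `n + 1 ≥ 2`. The zero of `S₀` at `-n` is therefore due to `1/Γ` alone.
-/
theorem completedLattice_neg_natCast_ne_zero {n : ℕ} (hn : 1 ≤ n) :
    completedLattice (-(n : ℂ)) ≠ 0 := by
  intro h
  rw [← completedLattice_one_sub, show (1 : ℂ) - -(n : ℂ) = ((n + 1 : ℕ) : ℂ) by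
    push_cast; ring] at h
  refine S₀_natCast_ne_zero (n := n + 1) (by omega) ?_
  rw [S₀_eq, h]
  · ring
  · exact_mod_cast (Nat.succ_ne_zero n)
  · intro h
    have h' := congrArg re h
    rw [natCast_re] at h'
    have : (1 : ℝ) ≤ ((n + 1 : ℕ) : ℝ) := by exact_mod_cast Nat.le_add_left 1 n
    norm_num at h'
    linarith
  · have : n + 1 ≠ 1 := by omega
    exact_mod_cast this

theorem isNontrivialZero_iff {s : ℂ} (h0 : s ≠ 0) (h1 : s ≠ 1 / 2) (h2 : s ≠ 1) :
    IsNontrivialZero s ↔ completedLattice s = 0 := by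
  have hpi : (Real.pi : ℂ) ^ s ≠ 0 := by simp [cpow_eq_zero_iff, Real.pi_ne_zero]
  rw [IsNontrivialZero, S₀_eq h0 h1 h2]
  constructor
  · rintro ⟨h, -, hn⟩
    have hG := Gamma_ne_zero hn
    simpa [hpi, hG] using h
  · intro h
    refine ⟨by rw [h]; ring, h2, ?_⟩
    rintro n rfl
    refine completedLattice_neg_natCast_ne_zero ?_ h
    rcases n with _ | n
    · simp at h0
    · omega

/-! ### The product identity and the condition `F = -1`. -/

theorem K_mul_add_K_mul {s : ℂ} (h0 : s ≠ 0) (h1 : s ≠ 1 / 2) (h2 : s ≠ 1) :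
    8 * (K 1 1 s 1 * ξ₁ (2 * s) + K 1 1 (1 - s) 1 * ξ₁ (2 * s - 1)) =
      completedLattice s * L s := by
  rw [L]
  linear_combination ξ₁ (2 * s) * eight_mul_K h0 h1 h2 +
    ξ₁ (2 * s - 1) * eight_mul_K_one_sub h0 h1 h2

/-- Division by zero yields zero, so a nonzero value of `F` certifies that every factor, and hence
every denominator, is nonzero. -/
theorem K_mul_eq_F_mul {s : ℂ} (hF : F s ≠ 0) :
    K 1 1 s 1 * ξ₁ (2 * s) = F s * (K 1 1 (1 - s) 1 * ξ₁ (2 * s - 1)) := by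
  have h := hF
  simp only [F, UK, U, ne_eq, div_eq_zero_iff, not_or] at h
  obtain ⟨⟨h1, h2⟩, h3, h4⟩ := h
  rw [F, UK, U]
  field_simp

/-- Near the point `F` is nonzero, so the cleared identity holds there; its factors other than `F`
are continuous at the point and it passes to the limit. -/
theorem K_mul_eq_neg_of_tendsto {s : ℂ} (h0 : s ≠ 0) (h1 : s ≠ 1 / 2) (h2 : s ≠ 1)
    (hF : Tendsto F (𝓝[≠] s) (𝓝 (-1))) :
    K 1 1 s 1 * ξ₁ (2 * s) = -(K 1 1 (1 - s) 1 * ξ₁ (2 * s - 1)) := by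
  have cA := (differentiableAt_ξ₁_two_mul h0 h1).continuousAt
  have cB := (differentiableAt_ξ₁_two_mul_sub_one h1 h2).continuousAt
  have cK := (differentiable_K_one_one s).continuousAt
  have cK' : ContinuousAt (fun s => K 1 1 (1 - s) 1) s :=
    (differentiable_K_one_one.comp (f := fun s : ℂ => 1 - s) (by fun_prop)).continuous.continuousAt
  have t1 := (cK.mul cA).tendsto.mono_left (nhdsWithin_le_nhds (s := {s}ᶜ))
  have t2 := hF.mul ((cK'.mul cB).tendsto.mono_left (nhdsWithin_le_nhds (s := {s}ᶜ)))
  rw [neg_one_mul] at t2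
  refine tendsto_nhds_unique_of_eventuallyEq t1 t2 ?_
  filter_upwards [hF.eventually_ne (show (-1 : ℂ) ≠ 0 by norm_num)] with z hz
  exact K_mul_eq_F_mul hz

end SquareLattice

open SquareLattice in
theorem theorem1 (s₀ : ℂ) (hs_zero : s₀ ≠ 0) (hs_half : s₀ ≠ 1 / 2) (hs_one : s₀ ≠ 1) :
    (IsNontrivialZero s₀ →
      K 1 1 s₀ 1 * ξ₁ (2 * s₀) = -(K 1 1 (1 - s₀) 1 * ξ₁ (2 * s₀ - 1)) ∧
      (ξ₁ (2 * s₀) ≠ 0 → ξ₁ (2 * s₀ - 1) ≠ 0 → K 1 1 (1 - s₀) 1 ≠ 0 ∧ F s₀ = -1)) ∧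
    ((F s₀ = -1 ∨ Tendsto F (𝓝[≠] s₀) (𝓝 (-1))) →
      (L s₀ = 0 ∨ IsNontrivialZero s₀) ∧ (L s₀ = 0 → s₀.re = 1 / 2)) := by
  have key := K_mul_add_K_mul hs_zero hs_half hs_one
  rw [isNontrivialZero_iff hs_zero hs_half hs_one]
  refine ⟨fun h => ?_, fun h => ⟨?_, re_eq_half_of_L_eq_zero hs_zero hs_one⟩⟩
  · have hK : K 1 1 s₀ 1 * ξ₁ (2 * s₀) = -(K 1 1 (1 - s₀) 1 * ξ₁ (2 * s₀ - 1)) := by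
      rw [h] at key
      linear_combination key / 8
    refine ⟨hK, fun hA hB => ?_⟩
    have hK' := eight_mul_K_one_sub hs_zero hs_half hs_one
    have h2 : 2 * s₀ - 1 ≠ 0 := fun h => hs_half (by linear_combination h / 2)
    -- Where `completedLattice` vanishes, `8 K 1 1 (1 - s₀) 1` reduces to `(2 s₀ - 1) ξ₁(2 s₀)`.
    have hne : K 1 1 (1 - s₀) 1 ≠ 0 := fun h3 => by
      rw [h, h3, mul_zero, mul_zero, zero_add] at hK'
      exact mul_ne_zero h2 hA hK'.symm
    refine ⟨hne, ?_⟩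
    rw [F, UK, U, div_div_div_eq, div_eq_iff (mul_ne_zero hne hB)]
    linear_combination hK
  · have hK : K 1 1 s₀ 1 * ξ₁ (2 * s₀) = -(K 1 1 (1 - s₀) 1 * ξ₁ (2 * s₀ - 1)) := by
      rcases h with h | h
      · have := K_mul_eq_F_mul (s := s₀) (by rw [h]; norm_num)
        rw [this, h, neg_one_mul]
      · exact K_mul_eq_neg_of_tendsto hs_zero hs_half hs_one h
    rw [hK, neg_add_cancel, mul_zero] at key
    exact (mul_eq_zero.1 key.symm).symm
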